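/- **Notation.** For $n\ge 0$ let $\mathrm{CF}(S_n)$ be the space of $\mathbb Q$-valued class functions on the symmetric group $S_n$, with the standard scalar product, and let $\Lambda_{\mathbb Q}=\bigoplus_{n\ge 0}\mathrm{CF}(S_n)$, the summands being mutually orthogonal. $\Lambda_{\mathbb Q}$ is a commutative graded algebra under the induction product $ff'=\mathrm{Ind}_{S_m\times S_n}^{S_{m+n}}(f\otimes f')$ for $f\in \mathrm{CF}(S_m)$, $f'\in\mathrm{CF}(S_n)$. For a partition $\lambda$, let $|\lambda|$ be its size, $l(\lambda)$ its number of parts, $m_i(\lambda)$ the multiplicity of the part $i$, and $z_\lambda=\prod_{i\ge 1} i^{m_i(\lambda)}m_i(\lambda)!$. Let $\tilde p_\lambda\in \mathrm{CF}(S_{|\lambda|})$ take the value $1$ on elements of cycle type $\lambda$ and $0$ elsewhere, let $p_\lambda=z_\lambda\tilde p_\lambda$, and let $s_\lambda$ be the usual irreducible character of $S_{|\lambda|}$ labelled by $\lambda$ (the character of the Specht module of shape $\lambda$). For a finite set $T$ and $w\in\mathbb Z_{\ge 0}$, let $\mathrm{PMap}(T)$ be the set of maps from $T$ to the set of all partitions,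 and let $\mathrm{PMap}_w(T)$ consist of those $\underline\lambda\in\mathrm{PMap}(T)$ with $\sum_{t\in T}|\underline\lambda(t)|=w$. For finite sets $T,Q$ and a rational $T\times Q$-matrix $A$, let $A^{\wr}(\mathtt s,\mathtt s)$ be the $\mathrm{PMap}(T)\times\mathrm{PMap}(Q)$-matrix with entries $$A^{\wr}(\mathtt s,\mathtt s)_{\underline\lambda\,\underline\mu}=\sum_{\underline\nu\in\mathrm{PMap}(T\times Q)}\ \prod_{t\in T}\Big\langle s_{\underline\lambda(t)},\prod_{q\in Q}\tilde p_{\underline\nu(t,q)}\Big\rangle\cdot\prod_{q\in Q}\Big\langle s_{\underline\mu(q)},\prod_{t\in T}p_{\underline\nu(t,q)}\Big\rangle\cdot\prod_{t\in T,\,q\in Q}A_{tq}^{\,l(\underline\nu(t,q))}$$ (only finitely many summands are nonzero, and $0^0=1$), and let $A^{\wr w}(\mathtt s,\mathtt s)$ be its $\mathrm{PMap}_w(T)\times\mathrm{PMap}_w(Q)$-submatrix. Two rational $a\times b$-matrices $X,Y$, where $a,b$ are finite index sets, are called $\mathbb Z$-equivalent if $Y=UXV$ for some $U\in \mathrm{GL}_a(\mathbb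 Z)$ and $V\in\mathrm{GL}_b(\mathbb Z)$. **Proposition.** Let $T$ and $Q$ be finite sets, and let $A$ and $B$ be rational (in particular, possibly integer) $T\times Q$-matrices. If $A$ and $B$ are $\mathbb Z$-equivalent, then for every integer $w\ge 0$ the matrices $A^{\wr w}(\mathtt s,\mathtt s)$ and $B^{\wr w}(\mathtt s,\mathtt s)$ are $\mathbb Z$-equivalent. -/

import Mathlib

noncomputable section

namespace WreathPower

open Equiv
open scoped DirectSum

/-! ### Class functions on finite groups -/

/-- `CF G` is the rational vector space of `ℚ`-valued class functions on the group `G`. -/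
def CF (G : Type*) [Group G] : Submodule ℚ (G → ℚ) where
  carrier := {f | ∀ x g, f (x * g * x⁻¹) = f g}
  add_mem' := fun ha hb x g => by simp only [Pi.add_apply, ha x g, hb x g]
  zero_mem' := fun _ _ => rfl
  smul_mem' := fun c _ ha x g => by simp only [Pi.smul_apply, ha x g]

namespace CF

section

variable {G H K L : Type*} [Group G] [Group H] [Group K] [Group L]

@[ext]
theorem ext {f f' : CF G} (h : ∀ g, f.1 g = f'.1 g) : f = f' := Subtype.ext (funext h)

/-- The standard scalar product of class functions on a finite group. -/
def inner [Fintype G] (f f' : CF G) : ℚ :=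
  (Fintype.card G : ℚ)⁻¹ * ∑ g : G, f.1 g * f'.1 g⁻¹

/-- The outer tensor product `(f ⊗ f') (g, h) = f g * f' h`. -/
def tensor (f : CF G) (f' : CF H) : CF (G × H) :=
  ⟨fun x => f.1 x.1 * f'.1 x.2, fun x g => by
    exact congrArg₂ (· * ·) (f.2 x.1 g.1) (f'.2 x.2 g.2)⟩

open Classical in
/-- The class function on `G` induced from a class function `f` on `H`, where `H` is viewed as a
subgroup of `G` through the (injective) homomorphism `ι`:
`(Ind f) g = |H|⁻¹ ∑_{x ∈ G, x⁻¹ g x ∈ H} f (x⁻¹ g x)`. -/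
def ind [Fintype G] [Fintype H] (ι : H →* G) (f : CF H) : CF G :=
  ⟨fun g => (Fintype.card H : ℚ)⁻¹ *
      ∑ x : G, ∑ h : H, if ι h = x⁻¹ * g * x then f.1 h else 0, fun y g => by
    refine congrArg ((Fintype.card H : ℚ)⁻¹ * ·) ?_
    refine Fintype.sum_equiv (Equiv.mulLeft y⁻¹) _ _ fun x => ?_
    refine Finset.sum_congr rfl fun h _ => ?_
    have : x⁻¹ * (y * g * y⁻¹) * x = (y⁻¹ * x)⁻¹ * g * (y⁻¹ * x) := by group
    rw [Equiv.coe_mulLeft, this]⟩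

/-- Pulling a class function back along a homomorphism. -/
def comap (φ : H →* G) (f : CF G) : CF H :=
  ⟨fun h => f.1 (φ h), fun x g => by
    have := f.2 (φ x) (φ g)
    simpa only [map_mul, map_inv] using this⟩

variable [Fintype G] [Fintype H] [Fintype K] [Fintype L]

theorem ind_add (ι : H →* G) (f f' : CF H) : ind ι (f + f') = ind ι f + ind ι f' := by
  ext g
  simp only [ind, Submodule.coe_add, Pi.add_apply, ← mul_add, ← Finset.sum_add_distrib]
  congr 1
  refine Finset.sum_congr rfl fun x _ => Finset.sum_congr rfl fun h _ => ?_
  split_ifs <;> simp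

theorem ind_zero (ι : H →* G) : ind ι 0 = 0 := by
  ext g
  simp [ind]

theorem ind_ind (ι : H →* K) (κ : K →* G) (f : CF H) :
    ind κ (ind ι f) = ind (κ.comp ι) f := by
  classical
  ext g
  have hK : (Fintype.card K : ℚ) ≠ 0 := Nat.cast_ne_zero.2 Fintype.card_ne_zero
  have step : ∀ x : G,
      (∑ k : K, if κ k = x⁻¹ * g * x then
        ((Fintype.card H : ℚ)⁻¹ * ∑ y : K, ∑ h : H, if ι h = y⁻¹ * k * y then f.1 h else 0)
        else 0)
      = (Fintype.card H : ℚ)⁻¹ * ∑ y : K, ∑ h : H,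
          if κ (ι h) = (x * κ y)⁻¹ * g * (x * κ y) then f.1 h else 0 := by
    intro x
    have : ∀ k : K, (if κ k = x⁻¹ * g * x then
        ((Fintype.card H : ℚ)⁻¹ * ∑ y : K, ∑ h : H, if ι h = y⁻¹ * k * y then f.1 h else 0)
        else 0) = (Fintype.card H : ℚ)⁻¹ * ∑ y : K, ∑ h : H,
          if k = y * ι h * y⁻¹ then (if κ k = x⁻¹ * g * x then f.1 h else 0) else 0 := by
      intro k
      split_ifs with hk
      · congr 1
        refine Finset.sum_congr rfl fun y _ => Finset.sum_congr rfl fun h _ => ?_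
        have : ι h = y⁻¹ * k * y ↔ k = y * ι h * y⁻¹ := by
          constructor
          · intro e; rw [e]; group
          · intro e; rw [e]; group
        simp only [this]
      · simp
    rw [Finset.sum_congr rfl fun k _ => this k, ← Finset.mul_sum, Finset.sum_comm]
    congr 1
    refine Finset.sum_congr rfl fun y _ => ?_
    rw [Finset.sum_comm]
    refine Finset.sum_congr rfl fun h _ => ?_
    rw [Finset.sum_ite_eq' Finset.univ (y * ι h * y⁻¹)]
    have : κ (y * ι h * y⁻¹) = x⁻¹ * g * x ↔
        κ (ι h) = (x * κ y)⁻¹ * g * (x * κ y) := by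
      rw [map_mul, map_mul, map_inv]
      constructor
      · intro e
        have : κ (ι h) = (κ y)⁻¹ * (κ y * κ (ι h) * (κ y)⁻¹) * κ y := by group
        rw [this, e]; group
      · intro e
        rw [e]; group
    simp only [Finset.mem_univ, if_true, this]
  change (Fintype.card K : ℚ)⁻¹ * ∑ x : G, (∑ k : K, if κ k = x⁻¹ * g * x then
        ((Fintype.card H : ℚ)⁻¹ * ∑ y : K, ∑ h : H, if ι h = y⁻¹ * k * y then f.1 h else 0)
        else 0) = (Fintype.card H : ℚ)⁻¹ * ∑ x : G, ∑ h : H,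
          if κ (ι h) = x⁻¹ * g * x then f.1 h else 0
  rw [Finset.sum_congr rfl fun x _ => step x, ← Finset.mul_sum, Finset.sum_comm]
  have : ∀ y : K, (∑ x : G, ∑ h : H,
      if κ (ι h) = (x * κ y)⁻¹ * g * (x * κ y) then f.1 h else 0) =
      ∑ x : G, ∑ h : H, if κ (ι h) = x⁻¹ * g * x then f.1 h else 0 := fun y =>
    Fintype.sum_equiv (Equiv.mulRight (κ y)) _ _ fun x => rfl
  rw [Finset.sum_congr rfl fun y _ => this y, Finset.sum_const, Finset.card_univ, nsmul_eq_mul]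
  field_simp

theorem ind_conj (ι : H →* G) (f : CF H) (z : G) :
    ind ((MulAut.conj z).toMonoidHom.comp ι) f = ind ι f := by
  classical
  ext g
  simp only [ind]
  congr 1
  refine Fintype.sum_equiv (Equiv.mulRight z) _ _ fun x => ?_
  refine Finset.sum_congr rfl fun h _ => ?_
  have : ((MulAut.conj z).toMonoidHom.comp ι) h = x⁻¹ * g * x ↔
      ι h = (x * z)⁻¹ * g * (x * z) := by
    change z * ι h * z⁻¹ = _ ↔ _
    constructor
    · intro e
      have : ι h = z⁻¹ * (z * ι h * z⁻¹) * z := by group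
      rw [this, e]; group
    · intro e
      rw [e]; group
  rw [Equiv.coe_mulRight]
  split_ifs <;> tauto

theorem ind_mulEquiv (e : H ≃* G) (f : CF G) :
    ind e.toMonoidHom (comap e.toMonoidHom f) = f := by
  classical
  ext g
  have hG : (Fintype.card G : ℚ) ≠ 0 := Nat.cast_ne_zero.2 Fintype.card_ne_zero
  have : ∀ x : G, (∑ h : H, if e h = x⁻¹ * g * x then f.1 (e h) else 0) = f.1 g := by
    intro x
    have hs : (∑ h : H, if e h = x⁻¹ * g * x then f.1 (e h) else 0) =
        ∑ k : G, if k = x⁻¹ * g * x then f.1 k else 0 :=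
      Fintype.sum_equiv e.toEquiv _ _ (fun h => rfl)
    rw [hs, Finset.sum_ite_eq' Finset.univ]
    have := f.2 x⁻¹ g
    rw [inv_inv] at this
    simp only [Finset.mem_univ, if_true, this]
  change (Fintype.card H : ℚ)⁻¹ * ∑ x : G, (∑ h : H, if e h = x⁻¹ * g * x then f.1 (e h) else 0)
    = f.1 g
  rw [Finset.sum_congr rfl fun x _ => this x, Finset.sum_const, Finset.card_univ, nsmul_eq_mul,
    Fintype.card_congr e.toEquiv]
  field_simp

theorem ind_id (f : CF G) : ind (MonoidHom.id G) f = f := ind_mulEquiv (MulEquiv.refl G) f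

theorem tensor_ind_left (ι : H →* K) (f : CF H) (l : CF L) :
    tensor (ind ι f) l = ind (ι.prodMap (MonoidHom.id L)) (tensor f l) := by
  classical
  ext ⟨k, m⟩
  have hL : (Fintype.card L : ℚ) ≠ 0 := Nat.cast_ne_zero.2 Fintype.card_ne_zero
  have key : ∀ (x : K) (y : L), (∑ h : H, ∑ n : L,
      if (ι.prodMap (MonoidHom.id L)) (h, n) = (x, y)⁻¹ * (k, m) * (x, y)
        then f.1 h * l.1 n else 0) =
      (∑ h : H, if ι h = x⁻¹ * k * x then f.1 h else 0) * l.1 m := by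
    intro x y
    rw [Finset.sum_mul]
    refine Finset.sum_congr rfl fun h _ => ?_
    have e : ∀ n : L, (ι.prodMap (MonoidHom.id L)) (h, n) = (x, y)⁻¹ * (k, m) * (x, y) ↔
        n = y⁻¹ * m * y ∧ ι h = x⁻¹ * k * x := by
      intro n
      simp [Prod.ext_iff, and_comm]
    simp only [e, ite_and]
    rw [Finset.sum_ite_eq' Finset.univ]
    have := l.2 y⁻¹ m
    rw [inv_inv] at this
    simp only [Finset.mem_univ, if_true, this, ite_mul, zero_mul]
  simp only [ind, tensor, Fintype.sum_prod_type, Fintype.card_prod, Nat.cast_mul]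
  rw [Finset.sum_congr rfl fun x _ => Finset.sum_congr rfl fun y _ => key x y]
  simp only [Finset.sum_const, Finset.card_univ, nsmul_eq_mul, ← Finset.mul_sum, ← Finset.sum_mul]
  field_simp

/-- Changing the source and the target of an induction along isomorphisms. -/
theorem ind_congr (e : H ≃* K) (ι : H →* G) (κ : K →* G) (z : G) (f : CF H) (f' : CF K)
    (hf : f = comap e.toMonoidHom f')
    (hι : ∀ h, z * κ (e h) * z⁻¹ = ι h) : ind ι f = ind κ f' := by
  have h1 : ι = (MulAut.conj z).toMonoidHom.comp (κ.comp e.toMonoidHom) :=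
    MonoidHom.ext fun h => (hι h).symm
  rw [h1, ind_conj, ← ind_ind, hf, ind_mulEquiv]

theorem ind_tensor_ind_right (ι : H →* K) (f : CF H) (l : CF L) (κ : L × K →* G) :
    ind κ (tensor l (ind ι f)) =
      ind ((κ.comp (MulEquiv.prodComm (M := K) (N := L)).toMonoidHom).comp
        (ι.prodMap (MonoidHom.id L))) (tensor f l) := by
  rw [← ind_ind, ← tensor_ind_left]
  exact (ind_congr MulEquiv.prodComm _ _ 1 _ _
    (by ext ⟨k, m⟩; exact mul_comm _ _) fun h => by simp).symm

end

end CF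

/-! ### The ring of class functions on symmetric groups -/

/-- The class functions on the symmetric group `S_n`. -/
abbrev SymCF (n : ℕ) : Type := CF (Perm (Fin n))

/-- The embedding of `S_m × S_n` as a Young subgroup of `S_{m+n}`. -/
def youngHom (m n : ℕ) : Perm (Fin m) × Perm (Fin n) →* Perm (Fin (m + n)) :=
  (finSumFinEquiv.permCongrHom.toMonoidHom).comp (Perm.sumCongrHom (Fin m) (Fin n))

theorem youngHom_castAdd {m n : ℕ} (x : Perm (Fin m) × Perm (Fin n)) (i : Fin m) :
    youngHom m n x (Fin.castAdd n i) = Fin.castAdd n (x.1 i) := by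
  simp [youngHom, Equiv.permCongrHom, Equiv.permCongr_apply]

theorem youngHom_natAdd {m n : ℕ} (x : Perm (Fin m) × Perm (Fin n)) (i : Fin n) :
    youngHom m n x (Fin.natAdd m i) = Fin.natAdd m (x.2 i) := by
  simp [youngHom, Equiv.permCongrHom, Equiv.permCongr_apply]

/-- The product of `f ∈ CF(S_m)` and `f' ∈ CF(S_n)` is the class function
`Ind_{S_m × S_n}^{S_{m+n}} (f ⊗ f')`. -/
def SymCF.mul {m n : ℕ} (f : SymCF m) (f' : SymCF n) : SymCF (m + n) :=
  CF.ind (youngHom m n) (CF.tensor f f')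

/-- The trivial character of `S_0`. -/
def SymCF.one : SymCF 0 := ⟨fun _ => 1, fun _ _ => rfl⟩

theorem mk_ind_eq {H K : Type*} [Group H] [Group K] [Fintype H] [Fintype K] {a b : ℕ} (hab : a = b)
    (ι : H →* Perm (Fin a)) (κ : K →* Perm (Fin b)) (e : H ≃* K) (f : CF H) (f' : CF K)
    (hf : f = CF.comap e.toMonoidHom f') (t : Fin a ≃ Fin b)
    (ht : ∀ h x, t (ι h x) = κ (e h) (t x)) :
    GradedMonoid.mk (A := SymCF) a (CF.ind ι f) = GradedMonoid.mk b (CF.ind κ f') := by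
  subst hab
  congr 1
  refine CF.ind_congr e ι κ t⁻¹ f f' hf fun h => ?_
  ext x
  congr 1
  rw [inv_inv]
  change t.symm (κ (e h) (t x)) = ι h x
  rw [← ht h x, Equiv.symm_apply_apply]

theorem SymCF.one_mul {n : ℕ} (f : SymCF n) :
    GradedMonoid.mk (A := SymCF) (0 + n) (SymCF.mul SymCF.one f) = GradedMonoid.mk n f := by
  have h := mk_ind_eq (zero_add n) (youngHom 0 n) (MonoidHom.id _) MulEquiv.uniqueProd
    (CF.tensor SymCF.one f) f (by ext ⟨x, y⟩; exact _root_.one_mul _) (finCongr (zero_add n))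
    (fun x i => by
      refine Fin.addCases (fun i => i.elim0) (fun i => ?_) i
      rw [youngHom_natAdd]
      ext
      simp)
  rwa [CF.ind_id] at h

theorem SymCF.mul_comm {m n : ℕ} (f : SymCF m) (f' : SymCF n) :
    GradedMonoid.mk (A := SymCF) (m + n) (SymCF.mul f f') =
      GradedMonoid.mk (n + m) (SymCF.mul f' f) := by
  refine mk_ind_eq (add_comm m n) _ _ MulEquiv.prodComm _ _
    (by ext ⟨x, y⟩; exact _root_.mul_comm _ _) finAddFlip (fun x i => ?_)
  refine Fin.addCases (fun i => ?_) (fun i => ?_) i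
  · rw [youngHom_castAdd, finAddFlip_apply_castAdd, finAddFlip_apply_castAdd, youngHom_natAdd]
    rfl
  · rw [youngHom_natAdd, finAddFlip_apply_natAdd, finAddFlip_apply_natAdd, youngHom_castAdd]
    rfl

theorem SymCF.mul_one {n : ℕ} (f : SymCF n) :
    GradedMonoid.mk (A := SymCF) (n + 0) (SymCF.mul f SymCF.one) = GradedMonoid.mk n f :=
  (SymCF.mul_comm f SymCF.one).trans (SymCF.one_mul f)

theorem SymCF.mul_assoc {m n k : ℕ} (f : SymCF m) (f' : SymCF n) (f'' : SymCF k) :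
    GradedMonoid.mk (A := SymCF) (m + n + k) (SymCF.mul (SymCF.mul f f') f'') =
      GradedMonoid.mk (m + (n + k)) (SymCF.mul f (SymCF.mul f' f'')) := by
  simp only [SymCF.mul]
  rw [CF.tensor_ind_left, CF.ind_ind, CF.ind_tensor_ind_right]
  refine mk_ind_eq (add_assoc m n k) _ _ (MulEquiv.prodAssoc.trans MulEquiv.prodComm) _ _
    (by
      ext ⟨⟨x, y⟩, z⟩
      change f.1 x * f'.1 y * f''.1 z = f'.1 y * f''.1 z * f.1 x
      ring)
    (finCongr (add_assoc m n k)) (fun x i => ?_)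
  obtain ⟨⟨x, y⟩, z⟩ := x
  change finCongr (add_assoc m n k) (youngHom (m + n) k (youngHom m n (x, y), z) i) =
    youngHom m (n + k) (x, youngHom n k (y, z)) (finCongr (add_assoc m n k) i)
  induction i using Fin.addCases with
  | left i =>
    induction i using Fin.addCases with
    | left i =>
      have h (j : Fin m) : finCongr (add_assoc m n k) (Fin.castAdd k (Fin.castAdd n j)) =
        Fin.castAdd (n + k) j := rfl
      rw [youngHom_castAdd, youngHom_castAdd, h, h, youngHom_castAdd]
    | right i =>
      have h (j : Fin n) : finCongr (add_assoc m n k) (Fin.castAdd k (Fin.natAdd m j)) =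
        Fin.natAdd m (Fin.castAdd k j) := rfl
      rw [youngHom_castAdd, youngHom_natAdd, h, h, youngHom_natAdd, youngHom_castAdd]
  | right i =>
    have h (j : Fin k) : finCongr (add_assoc m n k) (Fin.natAdd (m + n) j) =
      Fin.natAdd m (Fin.natAdd n j) := Fin.ext (add_assoc m n j)
    rw [youngHom_natAdd, h, h, youngHom_natAdd, youngHom_natAdd]

instance : GradedMonoid.GOne SymCF := ⟨SymCF.one⟩

instance : GradedMonoid.GMul SymCF := ⟨SymCF.mul⟩

/-- The induction product makes `⨁ n, CF(S_n)` a graded commutative ring. -/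
instance : DirectSum.GCommRing SymCF where
  mul_zero := fun a => by
    refine (congrArg (CF.ind _) ?_).trans (CF.ind_zero _)
    ext; exact MulZeroClass.mul_zero _
  zero_mul := fun a => by
    refine (congrArg (CF.ind _) ?_).trans (CF.ind_zero _)
    ext; exact MulZeroClass.zero_mul _
  mul_add := fun a b c => by
    refine (congrArg (CF.ind _) ?_).trans (CF.ind_add _ _ _)
    ext; exact _root_.mul_add _ _ _
  add_mul := fun a b c => by
    refine (congrArg (CF.ind _) ?_).trans (CF.ind_add _ _ _)
    ext; exact _root_.add_mul _ _ _
  one_mul := fun a => SymCF.one_mul a.2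
  mul_one := fun a => SymCF.mul_one a.2
  mul_assoc := fun a b c => SymCF.mul_assoc a.2 b.2 c.2
  mul_comm := fun a b => SymCF.mul_comm a.2 b.2
  natCast := fun n => (n : ℚ) • SymCF.one
  natCast_zero := by simp
  natCast_succ := fun n => by
    rw [Nat.cast_succ, add_smul, one_smul]
    rfl
  intCast := fun n => (n : ℚ) • SymCF.one
  intCast_ofNat := fun n => by simp
  intCast_negSucc_ofNat := fun n => by
    rw [Int.cast_negSucc]
    exact neg_smul ((n + 1 : ℕ) : ℚ) SymCF.one

/-- The commutative ring `Λ_ℚ = ⨁ n, CF(S_n)`. -/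
abbrev Lam : Type := ⨁ n : ℕ, SymCF n

/-- The element of `Λ_ℚ`, homogeneous of degree `n`, given by a class function on `S_n`. -/
def Lam.of {n : ℕ} (f : SymCF n) : Lam := DirectSum.of SymCF n f

/-- The scalar product on `Λ_ℚ`: the standard one on each `CF(S_n)`, the components `CF(S_n)` being
orthogonal to each other. Only finitely many summands are nonzero. -/
def Lam.inner (f f' : Lam) : ℚ := ∑ᶠ n : ℕ, CF.inner (f n) (f' n)

/-! ### Partitions and the bases of `Λ_ℚ` -/

/-- The set of all partitions. -/
abbrev Par : Type := Σ n : ℕ, Nat.Partition n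

namespace Par

/-- The size `|λ|` of a partition `λ`. -/
def size (l : Par) : ℕ := l.1

/-- The multiset of parts of a partition. -/
def parts (l : Par) : Multiset ℕ := l.2.parts

/-- The length `l(λ)` of a partition `λ`, that is, the number of its parts. -/
def length (l : Par) : ℕ := l.parts.card

/-- `z_λ = ∏_i i ^ m_i(λ) * m_i(λ)!`, where `m_i(λ)` is the multiplicity of the part `i`. -/
def z (l : Par) : ℕ :=
  ∏ i ∈ l.parts.toFinset, i ^ l.parts.count i * (l.parts.count i).factorial

/-- The class function on `S_{|λ|}` with value `1` on elements of cycle type `λ` and `0` elsewhere.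
(`Equiv.Perm.partition` is the cycle type including the fixed points.) -/
def ptildeCF (l : Par) : SymCF l.1 :=
  ⟨fun g => if g.partition.parts = l.parts then 1 else 0, fun x g => by
    have : (x * g * x⁻¹).partition = g.partition :=
      (Perm.partition_eq_of_isConj.1 (isConj_iff.2 ⟨x, rfl⟩)).symm
    simp only [this]⟩

/-- The element `p̃_λ` of `Λ_ℚ`. -/
def ptilde (l : Par) : Lam := Lam.of l.ptildeCF

/-- The power sum element `p_λ = z_λ p̃_λ` of `Λ_ℚ`. -/
def p (l : Par) : Lam := Lam.of ((l.z : ℚ) • l.ptildeCF)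

/-- The parts of `λ` in weakly decreasing order, as a composition of `|λ|`. -/
def rows (l : Par) : Composition l.1 where
  blocks := l.2.parts.sort (· ≥ ·)
  blocks_pos := fun h => l.2.parts_pos ((Multiset.mem_sort _).1 h)
  blocks_sum := by
    rw [← Multiset.sum_coe, Multiset.sort_eq, l.2.parts_sum]

/-- The row containing `i` in the Young tableau of shape `λ` that is filled with
`0, 1, …, |λ| - 1` row by row. -/
def rowIdx (l : Par) (i : Fin l.1) : ℕ := l.rows.index i

/-- The column containing `i` in the Young tableau of shape `λ` that is filled with
`0, 1, …, |λ| - 1` row by row. -/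
def colIdx (l : Par) (i : Fin l.1) : ℕ := l.rows.invEmbedding i

open Classical in
/-- The Young symmetrizer `(∑_p p) (∑_q sgn(q) q)` of that tableau in `ℚ[S_{|λ|}]`, where `p` runs
through the row stabilizer and `q` through the column stabilizer. -/
def youngSymmetrizer (l : Par) : MonoidAlgebra ℚ (Perm (Fin l.1)) :=
  (∑ p : Perm (Fin l.1) with ∀ i, l.rowIdx (p i) = l.rowIdx i, MonoidAlgebra.of ℚ _ p) *
  (∑ q : Perm (Fin l.1) with ∀ i, l.colIdx (q i) = l.colIdx i,
    ((Perm.sign q : ℤ) : ℚ) • MonoidAlgebra.of ℚ _ q)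

/-- The Specht module of shape `λ`: the left ideal of `ℚ[S_{|λ|}]` generated by the Young
symmetrizer. -/
def spechtModule (l : Par) :
    Submodule (MonoidAlgebra ℚ (Perm (Fin l.1))) (MonoidAlgebra ℚ (Perm (Fin l.1))) :=
  Submodule.span _ {l.youngSymmetrizer}

/-- The irreducible representation of `S_{|λ|}` over `ℚ` labelled by `λ`. -/
def spechtRep (l : Par) : Representation ℚ (Perm (Fin l.1)) l.spechtModule :=
  Representation.ofModule' l.spechtModule

/-- The irreducible character of `S_{|λ|}` labelled by `λ`. -/
def sCF (l : Par) : SymCF l.1 := ⟨l.spechtRep.character, fun x g => l.spechtRep.char_conj g x⟩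

/-- The element `s_λ` of `Λ_ℚ`. -/
def s (l : Par) : Lam := Lam.of l.sCF

end Par

/-! ### Wreath powers of matrices -/

/-- `PMap T` is the set of all maps from `T` to the set of partitions. -/
abbrev PMap (T : Type*) : Type _ := T → Par

/-- `|λ| = ∑_{t ∈ T} |λ(t)|` for `λ ∈ PMap T`. -/
def PMap.size {T : Type*} [Fintype T] (l : PMap T) : ℕ := ∑ t, (l t).size

/-- `PMapW T w` is the set of all `λ ∈ PMap T` such that `|λ| = w`. -/
abbrev PMapW (T : Type*) [Fintype T] (w : ℕ) : Type _ := {l : PMap T // l.size = w}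

instance PMapW.finite (T : Type*) [Fintype T] (w : ℕ) : Finite (PMapW T w) := by
  classical
  let F : PMapW T w → (T → Σ n : Fin (w + 1), Nat.Partition n) := fun l t =>
    ⟨⟨(l.1 t).1, Nat.lt_succ_of_le (by
      refine le_of_le_of_eq ?_ l.2
      exact Finset.single_le_sum (f := fun t => (l.1 t).size) (fun _ _ => Nat.zero_le _)
        (Finset.mem_univ t))⟩, (l.1 t).2⟩
  refine Finite.of_injective F fun l l' h => Subtype.ext (funext fun t => ?_)
  have ht := congrFun h t
  have := congrArg (fun x : Σ n : Fin (w + 1), Nat.Partition n => (⟨x.1, x.2⟩ : Par)) ht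
  exact this

instance PMapW.fintype (T : Type*) [Fintype T] (w : ℕ) : Fintype (PMapW T w) := Fintype.ofFinite _

/-- The `PMap T × PMap Q`-matrix `A^≀(u, v)`, for a rational `T × Q`-matrix `A` and two families
`u`, `v` of elements of `Λ_ℚ` indexed by partitions (graded bases of `Λ_ℚ` with `u_λ`, `v_λ` of
degree `|λ|`). For such families a summand vanishes unless `∑_q |ν(t,q)| = |λ(t)|` for all `t`, so
the sum has only finitely many nonzero summands. -/
def wreath {T Q : Type*} [Fintype T] [Fintype Q] (A : Matrix T Q ℚ) (u v : Par → Lam) :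
    Matrix (PMap T) (PMap Q) ℚ := fun l m =>
  ∑ᶠ ν : PMap (T × Q),
    (∏ t, Lam.inner (u (l t)) (∏ q, (ν (t, q)).ptilde)) *
    (∏ q, Lam.inner (v (m q)) (∏ t, (ν (t, q)).p)) *
    ∏ t, ∏ q, A t q ^ (ν (t, q)).length

/-- The `PMapW T w × PMapW Q w`-submatrix `A^{≀w}(u, v)` of `A^≀(u, v)`. -/
def wreathPow {T Q : Type*} [Fintype T] [Fintype Q] (A : Matrix T Q ℚ) (w : ℕ) (u v : Par → Lam) :
    Matrix (PMapW T w) (PMapW Q w) ℚ :=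
  (wreath A u v).submatrix Subtype.val Subtype.val

/-- Two `R'`-valued `a × b`-matrices `A`, `B` are equivalent over `R` if `B = U A V` for some
`U ∈ GL_a(R)` and `V ∈ GL_b(R)`. -/
def EquivalentOver (R : Type*) {R' a b : Type*} [CommRing R] [CommRing R'] [Algebra R R']
    [Fintype a] [DecidableEq a] [Fintype b] [DecidableEq b] (A B : Matrix a b R') : Prop :=
  ∃ (U : Matrix.GeneralLinearGroup a R) (V : Matrix.GeneralLinearGroup b R),
    B = (U : Matrix a a R).map (algebraMap R R') * A * (V : Matrix b b R).map (algebraMap R R')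

end WreathPower

end

noncomputable section

namespace WreathPower

open Equiv
open scoped DirectSum

namespace Par

/-! ### Combinatorics of tableaux -/

/-! Read a partition-valued map σ on Q as the monomial ∏_q p_{σ(q)} in variables "p_k at q". Formal
combinations of these form the polynomial ring `PAlg Q`, and a matrix A gives the algebra
homomorphism `substHom A` sending p_k at q to ∑_t A_tq (p_k at t). On generators composition is
matrix multiplication, so A ↦ `substHom A` is functorial.

Expanding the image of σ multinomially produces the coefficients z_σ ∏ A_tq^{l(ν(t,q))} / z_{ν(t,q)}
(`coeff_splitHom`). Consequently A^{≀w}(s,s) is the matrix of `substHom A` in degree w with respect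
to products of Schur functions (`wreathPow_s_apply`), and wreath powers are multiplicative and
unital (`wreathPow_mul`, `wreathPow_one`). The change of basis needs the s_λ to be orthonormal
(`inner_sCF`); since they are characters of Specht modules, this is proved with Young symmetrizers.

It remains to see that integral A have integral wreath powers (`exists_int_wreathPow`). A sum over ν
with weights 1/z_ν is a sum of averages over groups ∏ S_{n(t,q)}. The averaged function is a product
of irreducible characters pulled back along Young subgroups and of functions g ↦ a^{number of cycles
of g}. The latter are virtual characters: for a ≥ 0 they count words fixed by g, and a negative a
adds a sign twist. Averages of virtual characters are integers.

If B = UAV, then B^{≀w} = U^{≀w} A^{≀w} V^{≀w}, and the outer factors are integral with integral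
inverses, the wreath powers of U⁻¹ and V⁻¹. No integrality of A or B is used. -/

theorem exists_cell_iff (l : Par) (r j : ℕ) : (∃ i, l.rowIdx i = r ∧ l.colIdx i = j) ↔
    ∃ h : r < l.rows.length, j < l.rows.blocksFun ⟨r, h⟩ := by
  constructor
  · rintro ⟨i, rfl, rfl⟩
    exact ⟨(l.rows.index i).2, (l.rows.invEmbedding i).2⟩
  · rintro ⟨h, hj⟩
    refine ⟨l.rows.embedding ⟨r, h⟩ ⟨j, hj⟩, ?_, l.rows.invEmbedding_comp ⟨r, h⟩ ⟨j, hj⟩⟩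
    rw [rowIdx, l.rows.index_embedding]

theorem cell_injective (l : Par) {i i' : Fin l.1} (hr : l.rowIdx i = l.rowIdx i')
    (hc : l.colIdx i = l.colIdx i') : i = i' := by
  have hr' : l.rows.index i = l.rows.index i' := Fin.ext hr
  have h1 := l.rows.coe_invEmbedding i
  have h2 := l.rows.coe_invEmbedding i'
  have h3 := l.rows.sizeUpTo_index_le i
  have h4 := l.rows.sizeUpTo_index_le i'
  have hc' : (l.rows.invEmbedding i : ℕ) = l.rows.invEmbedding i' := hc
  have h5 := congrArg (fun k => l.rows.sizeUpTo (k : Fin _)) hr'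
  ext
  omega

theorem blocksFun_antitone (l : Par) : Antitone l.rows.blocksFun := by
  intro i j hij
  rcases hij.eq_or_lt with rfl | hij
  · exact le_rfl
  · exact List.pairwise_iff_get.1 (Multiset.pairwise_sort l.2.parts (· ≥ ·)) i j hij

/-- The cells of a Young diagram are described by the heights of its columns. -/
theorem exists_colHeight (l : Par) : ∃ h : ℕ → ℕ, ∀ r j,
    (∃ i, l.rowIdx i = r ∧ l.colIdx i = j) ↔ r < h j := by
  classical
  -- The height of a column is its first missing row; as the row lengths decrease, no cell of the
  -- column lies below it.
  have ex : ∀ j, ∃ r, ¬ ∃ i, l.rowIdx i = r ∧ l.colIdx i = j := fun j =>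
    ⟨l.rows.length, by rw [exists_cell_iff]; rintro ⟨h, -⟩; exact lt_irrefl _ h⟩
  refine ⟨fun j => Nat.find (ex j), fun r j => ?_⟩
  rw [Nat.lt_find_iff]
  refine ⟨fun hr m hm => ?_, fun h => not_not.1 (h r le_rfl)⟩
  rw [exists_cell_iff] at hr ⊢
  obtain ⟨h, hj⟩ := hr
  exact not_not.2 ⟨hm.trans_lt h, hj.trans_le (l.blocksFun_antitone (Fin.mk_le_mk.2 hm))⟩

/-- Among all finite sets, D collects exactly the negative values of φ, so it minimizes the sum;
omitting any point of D makes the sum strictly larger. -/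
theorem subset_of_sum_le {α : Type*} [DecidableEq α] (S D : Finset α) (φ : α → ℤ)
    (hD : ∀ x, x ∈ D ↔ φ x < 0) (h : ∑ x ∈ S, φ x ≤ ∑ x ∈ D, φ x) : D ⊆ S := by
  by_contra hDS
  obtain ⟨x, hx, hxS⟩ := Finset.not_subset.1 hDS
  have h1 := Finset.sum_inter_add_sum_sdiff D S φ
  have h2 := Finset.sum_inter_add_sum_sdiff S D φ
  have h3 : 0 ≤ ∑ x ∈ S \ D, φ x := Finset.sum_nonneg fun y hy => by
    have := (not_congr (hD y)).1 (Finset.mem_sdiff.1 hy).2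
    omega
  have h4 : ∑ x ∈ D \ S, φ x < 0 :=
    Finset.sum_neg (fun y hy => (hD y).1 (Finset.mem_sdiff.1 hy).1)
      ⟨x, Finset.mem_sdiff.2 ⟨hx, hxS⟩⟩
  rw [Finset.inter_comm] at h2
  omega

/-- If no two entries lie both in one row of the tableau of shape `a` and in one column of the
tableau of shape `b` permuted by `g`, and `a` does not exceed `b` in the sum of its row indices, then
the cells found in this way form the diagram of `b`. -/
theorem exists_perm_of_injective {n : ℕ} (a b : n.Partition)
    (hab : ∑ i, rowIdx ⟨n, a⟩ i ≤ ∑ i, rowIdx ⟨n, b⟩ i) (g : Perm (Fin n))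
    (hg : ∀ i j, rowIdx ⟨n, a⟩ i = rowIdx ⟨n, a⟩ j →
      colIdx ⟨n, b⟩ (g⁻¹ i) = colIdx ⟨n, b⟩ (g⁻¹ j) → i = j) :
    ∃ π : Perm (Fin n), ∀ i, rowIdx ⟨n, b⟩ (π i) = rowIdx ⟨n, a⟩ i ∧
      colIdx ⟨n, b⟩ (π i) = colIdx ⟨n, b⟩ (g⁻¹ i) := by
  classical
  obtain ⟨h, hh⟩ := exists_colHeight ⟨n, b⟩
  let F : Fin n → ℕ × ℕ := fun i => (rowIdx ⟨n, a⟩ i, colIdx ⟨n, b⟩ (g⁻¹ i))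
  let E : Fin n → ℕ × ℕ := fun i => (rowIdx ⟨n, b⟩ i, colIdx ⟨n, b⟩ i)
  have hF : Function.Injective F := fun i j hij =>
    hg i j (congrArg Prod.fst hij) (congrArg Prod.snd hij)
  have hE : Function.Injective E := fun i j hij =>
    cell_injective ⟨n, b⟩ (congrArg Prod.fst hij) (congrArg Prod.snd hij)
  -- φ is negative exactly on the cells of b. The column indices in F are those in E permuted by
  -- g⁻¹, so the terms in h have equal sums and only the row indices are compared.
  let φ : ℕ × ℕ → ℤ := fun x => x.1 - h x.2
  have hsub : Finset.univ.image E ⊆ Finset.univ.image F := by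
    refine subset_of_sum_le _ _ φ (fun x => ?_) ?_
    · have := hh x.1 x.2
      simp only [Finset.mem_image, Finset.mem_univ, true_and, φ, sub_neg, Nat.cast_lt, ← this, E,
        Prod.ext_iff]
    · rw [Finset.sum_image fun _ _ _ _ e => hF e, Finset.sum_image fun _ _ _ _ e => hE e]
      simp only [φ, F, E, Finset.sum_sub_distrib]
      rw [Equiv.sum_comp g⁻¹ (fun i => (h (colIdx ⟨n, b⟩ i) : ℤ))]
      have : (∑ i, (rowIdx ⟨n, a⟩ i : ℤ)) ≤ ∑ i, (rowIdx ⟨n, b⟩ i : ℤ) := by exact_mod_cast hab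
      linarith
  have heq : Finset.univ.image E = Finset.univ.image F :=
    Finset.eq_of_subset_of_card_le hsub (by
      rw [Finset.card_image_of_injective _ hF, Finset.card_image_of_injective _ hE])
  have hex : ∀ i, ∃ k, E k = F i := fun i => by
    have : F i ∈ Finset.univ.image E := heq ▸ Finset.mem_image_of_mem F (Finset.mem_univ i)
    simpa using this
  choose π hπ using hex
  have hinj : Function.Injective π := fun i j hij => hF (by rw [← hπ, ← hπ, hij])
  exact ⟨Equiv.ofBijective π (Finite.injective_iff_bijective.1 hinj), fun i =>
    ⟨congrArg Prod.fst (hπ i), congrArg Prod.snd (hπ i)⟩⟩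

theorem card_rowIdx_eq (l : Par) (r : ℕ) :
    (Finset.univ.filter fun i => l.rowIdx i = r).card = l.rows.blocks.getD r 0 := by
  classical
  by_cases h : r < l.rows.length
  · have : (Finset.univ.filter fun i => l.rowIdx i = r) =
        Finset.univ.map (l.rows.embedding ⟨r, h⟩).toEmbedding := by
      ext i
      have := l.rows.mem_range_embedding_iff' (j := i) (i := ⟨r, h⟩)
      simp only [Finset.mem_filter, Finset.mem_univ, true_and, Finset.mem_map,
        RelEmbedding.coe_toEmbedding]
      rw [← Set.mem_range, this, rowIdx, Fin.ext_iff, eq_comm]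
    rw [this, Finset.card_map, Finset.card_univ, Fintype.card_fin, Composition.blocksFun,
      List.getD_eq_getElem _ _ h]
    rfl
  · rw [List.getD_eq_default _ _ (not_lt.1 h), Finset.card_eq_zero, Finset.filter_eq_empty_iff]
    exact fun i _ e => h (e ▸ (l.rows.index i).2)

/-- The row lengths are the fibre cardinalities of `rowIdx`, which such a permutation preserves. -/
theorem eq_of_rowIdx_comp {n : ℕ} (a b : n.Partition) (π : Perm (Fin n))
    (h : ∀ i, rowIdx ⟨n, b⟩ (π i) = rowIdx ⟨n, a⟩ i) : a = b := by
  classical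
  have hget : ∀ r, (rows ⟨n, a⟩).blocks.getD r 0 = (rows ⟨n, b⟩).blocks.getD r 0 := fun r => by
    rw [← card_rowIdx_eq, ← card_rowIdx_eq]
    refine Finset.card_bij (fun i _ => π i) (fun i hi => ?_) (fun _ _ _ _ e => π.injective e)
      fun i hi => ⟨π⁻¹ i, ?_, by simp⟩
    · simpa [h] using hi
    · simpa [← h] using hi
  -- Blocks are positive, so the default value 0 of `getD` marks the end of the list.
  have hpos : ∀ (c : Composition n) r, r < c.blocks.length ↔ 0 < c.blocks.getD r 0 := by
    intro c r
    by_cases hr : r < c.blocks.length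
    · rw [List.getD_eq_getElem _ _ hr]
      exact ⟨fun _ => c.blocks_pos (List.getElem_mem _), fun _ => hr⟩
    · rw [List.getD_eq_default _ _ (not_lt.1 hr)]
      simp [hr]
  have hlen : (rows ⟨n, a⟩).blocks.length = (rows ⟨n, b⟩).blocks.length := by
    refine eq_of_forall_lt_iff fun r => ?_
    rw [hpos, hpos, hget]
  have hb : (rows ⟨n, a⟩).blocks = (rows ⟨n, b⟩).blocks :=
    List.ext_getElem hlen fun r h1 h2 => by
      rw [← List.getD_eq_getElem _ 0 h1, ← List.getD_eq_getElem _ 0 h2, hget]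
  have := congrArg (fun L : List ℕ => (L : Multiset ℕ)) hb
  simp only [rows, Multiset.sort_eq] at this
  exact Nat.Partition.ext this

end Par
end WreathPower
end

noncomputable section

namespace WreathPower

open Equiv
open scoped DirectSum

namespace Par

/-! ### Orthonormality of the characters of the Specht modules -/

open Classical in
/-- The row symmetrizer of the standard tableau of shape `l`. -/
def rowSum (l : Par) : MonoidAlgebra ℚ (Perm (Fin l.1)) :=
  ∑ p : Perm (Fin l.1) with ∀ i, l.rowIdx (p i) = l.rowIdx i, MonoidAlgebra.of ℚ _ p

open Classical in
/-- The column antisymmetrizer of the standard tableau of shape `l`. -/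
def colSum (l : Par) : MonoidAlgebra ℚ (Perm (Fin l.1)) :=
  ∑ q : Perm (Fin l.1) with ∀ i, l.colIdx (q i) = l.colIdx i,
    ((Perm.sign q : ℤ) : ℚ) • MonoidAlgebra.of ℚ _ q

theorem youngSymmetrizer_eq (l : Par) : l.youngSymmetrizer = l.rowSum * l.colSum := rfl

theorem rowSum_mul_of (l : Par) (p : Perm (Fin l.1)) (hp : ∀ i, l.rowIdx (p i) = l.rowIdx i) :
    l.rowSum * MonoidAlgebra.of ℚ _ p = l.rowSum := by
  classical
  rw [rowSum, Finset.sum_mul]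
  refine Finset.sum_bij' (fun x _ => x * p) (fun x _ => x * p⁻¹) (fun x hx => ?_) (fun x hx => ?_)
    (fun x _ => by simp) (fun x _ => by simp) fun x _ => by rw [map_mul]
  · simp only [Finset.mem_filter, Finset.mem_univ, true_and] at hx ⊢
    exact fun i => by rw [Perm.mul_apply, hx, hp]
  · simp only [Finset.mem_filter, Finset.mem_univ, true_and] at hx ⊢
    exact fun i => by rw [Perm.mul_apply, hx, ← hp]; simp

theorem of_mul_colSum (l : Par) (q : Perm (Fin l.1)) (hq : ∀ i, l.colIdx (q i) = l.colIdx i) :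
    MonoidAlgebra.of ℚ _ q * l.colSum = ((Perm.sign q : ℤ) : ℚ) • l.colSum := by
  classical
  have hq' : ∀ i, l.colIdx (q⁻¹ i) = l.colIdx i := fun i => by
    rw [← hq]; simp
  have hs : ((Perm.sign q : ℤ) : ℚ) * ((Perm.sign q : ℤ) : ℚ) = 1 := by
    rw [← Int.cast_mul, ← Units.val_mul, Int.units_mul_self]; simp
  rw [colSum, Finset.mul_sum, Finset.smul_sum]
  refine Finset.sum_bij' (fun x _ => q * x) (fun x _ => q⁻¹ * x) (fun x hx => ?_) (fun x hx => ?_)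
    (fun x _ => by simp) (fun x _ => by simp) fun x _ => ?_
  · simp only [Finset.mem_filter, Finset.mem_univ, true_and] at hx ⊢
    exact fun i => by rw [Perm.mul_apply, hq, hx]
  · simp only [Finset.mem_filter, Finset.mem_univ, true_and] at hx ⊢
    exact fun i => by rw [Perm.mul_apply, hq', hx]
  · rw [map_mul, map_mul, Units.val_mul, Int.cast_mul, smul_smul, ← mul_assoc, hs, one_mul,
      mul_smul_comm]

section

variable {n : ℕ} {a b : n.Partition} {g : Perm (Fin n)}

/-- The transposition of i and j is absorbed by the row sum; moved past g it becomes a column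
transposition and changes the sign of the column sum. The product thus equals its own negative. -/
theorem rowSum_mul_of_mul_colSum_eq_zero {i j : Fin n} (hij : i ≠ j)
    (hr : rowIdx ⟨n, a⟩ i = rowIdx ⟨n, a⟩ j)
    (hc : colIdx ⟨n, b⟩ (g⁻¹ i) = colIdx ⟨n, b⟩ (g⁻¹ j)) :
    rowSum ⟨n, a⟩ * MonoidAlgebra.of ℚ _ g * colSum ⟨n, b⟩ = 0 := by
  have h1 := rowSum_mul_of ⟨n, a⟩ (swap i j) fun k => by
    rw [swap_apply_def]; split_ifs with h h <;> simp [h, hr]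
  have h2 := of_mul_colSum ⟨n, b⟩ (swap (g⁻¹ i) (g⁻¹ j)) fun k => by
    rw [swap_apply_def]; split_ifs with h h <;> simp only [h, hc]
  rw [Perm.sign_swap (g⁻¹.injective.ne hij)] at h2
  have h3 : swap i j * g = g * swap (g⁻¹ i) (g⁻¹ j) := by
    rw [Equiv.mul_swap_eq_swap_mul]; simp
  have h4 : rowSum ⟨n, a⟩ * MonoidAlgebra.of ℚ _ g * colSum ⟨n, b⟩ =
      -(rowSum ⟨n, a⟩ * MonoidAlgebra.of ℚ _ g * colSum ⟨n, b⟩) := by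
    conv_lhs => rw [← h1, mul_assoc (rowSum _), ← map_mul, h3, map_mul, ← mul_assoc, mul_assoc, h2]
    simp
  have := IsAddTorsionFree.of_isTorsionFree ℚ (MonoidAlgebra ℚ (Perm (Fin n)))
  exact self_eq_neg.1 h4

/-- Here the sum of the row indices does the work of the dominance order: a nonzero term at some g
would, by `exists_perm_of_injective`, match the rows of a with those of b. -/
theorem rowSum_mul_mul_colSum_eq_zero (hne : a ≠ b)
    (hab : ∑ i, rowIdx ⟨n, a⟩ i ≤ ∑ i, rowIdx ⟨n, b⟩ i) (x : MonoidAlgebra ℚ (Perm (Fin n))) :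
    rowSum ⟨n, a⟩ * x * colSum ⟨n, b⟩ = 0 := by
  induction x using MonoidAlgebra.induction_on with
  | of g =>
    by_contra h
    obtain ⟨π, hπ⟩ := exists_perm_of_injective a b hab g fun i j hr hc => by
      by_contra hij
      exact h (rowSum_mul_of_mul_colSum_eq_zero hij hr hc)
    exact hne (eq_of_rowIdx_comp a b π fun i => (hπ i).1)
  | add x y hx hy => rw [mul_add, add_mul, hx, hy, add_zero]
  | smul r x hx => rw [mul_smul_comm, smul_mul_assoc, hx, smul_zero]

/-- If no pair of entries shares a row and a g-translated column, then g = π⁻¹ (π g) with π in the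
row and π g in the column stabilizer, and the product is plus or minus the Young symmetrizer;
otherwise it vanishes. -/
theorem exists_rowSum_mul_mul_colSum (x : MonoidAlgebra ℚ (Perm (Fin n))) :
    ∃ c : ℚ, rowSum ⟨n, a⟩ * x * colSum ⟨n, a⟩ = c • youngSymmetrizer ⟨n, a⟩ := by
  induction x using MonoidAlgebra.induction_on with
  | of g =>
    by_cases hg : ∀ i j, rowIdx ⟨n, a⟩ i = rowIdx ⟨n, a⟩ j →
        colIdx ⟨n, a⟩ (g⁻¹ i) = colIdx ⟨n, a⟩ (g⁻¹ j) → i = j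
    · obtain ⟨π, hπ⟩ := exists_perm_of_injective a a le_rfl g hg
      have h1 := rowSum_mul_of ⟨n, a⟩ π⁻¹ fun i => by
        rw [← (hπ (π⁻¹ i)).1]; simp
      have h2 := of_mul_colSum ⟨n, a⟩ (π * g) fun i => by
        rw [Perm.mul_apply, (hπ (g i)).2]; simp
      refine ⟨((Perm.sign (π * g) : ℤ) : ℚ), ?_⟩
      have h3 : g = π⁻¹ * (π * g) := by group
      rw [youngSymmetrizer_eq, ← mul_smul_comm, ← h2, ← mul_assoc]
      conv_rhs => rw [← h1, mul_assoc (rowSum _), ← map_mul, ← h3]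
    · push Not at hg
      obtain ⟨i, j, hr, hc, hij⟩ := hg
      exact ⟨0, by rw [rowSum_mul_of_mul_colSum_eq_zero hij hr hc, zero_smul]⟩
  | add x y hx hy =>
    obtain ⟨c, hx⟩ := hx
    obtain ⟨d, hy⟩ := hy
    exact ⟨c + d, by rw [mul_add, add_mul, hx, hy, add_smul]⟩
  | smul r x hx =>
    obtain ⟨c, hx⟩ := hx
    exact ⟨r * c, by rw [mul_smul_comm, smul_mul_assoc, hx, smul_smul]⟩

end

/-- The coefficient at 1 is 1: a permutation preserving all rows and all columns is trivial, so only
p = q = 1 contributes. -/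
theorem youngSymmetrizer_ne_zero (l : Par) : l.youngSymmetrizer ≠ 0 := by
  classical
  intro h
  have h1 := congrArg (fun x => x.coeff 1) h
  rw [youngSymmetrizer_eq, rowSum, colSum, Finset.sum_mul] at h1
  simp only [Finset.mul_sum, mul_smul_comm, MonoidAlgebra.single_mul_single, MonoidAlgebra.coeff_sum,
    MonoidAlgebra.coeff_smul, MonoidAlgebra.of_apply, MonoidAlgebra.coeff_single,
    Finsupp.coe_finsetSum, Finset.sum_apply, Finsupp.smul_apply, Finsupp.single_apply,
    MonoidAlgebra.coeff_zero, Finsupp.zero_apply] at h1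
  rw [Finset.sum_eq_single 1, Finset.sum_eq_single 1] at h1
  · simp at h1
  · intro q _ hq
    rw [one_mul, if_neg hq, smul_zero]
  · intro h; simp at h
  · intro p hp hp1
    refine Finset.sum_eq_zero fun q hq => ?_
    rw [if_neg, smul_zero]
    intro e
    simp only [Finset.mem_filter, Finset.mem_univ, true_and] at hp hq
    have : q = p⁻¹ := (inv_eq_of_mul_eq_one_right e).symm
    refine hp1 (Perm.ext fun i => ?_)
    refine l.cell_injective (hp i) ?_
    rw [← hq, this]; simp
  · intro h; simp at h

theorem spechtRep_apply (l : Par) (g : Perm (Fin l.1)) (v : l.spechtModule) :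
    l.spechtRep g v = MonoidAlgebra.of ℚ _ g • v := by
  simp [spechtRep, Representation.ofModule']

instance (l : Par) : FiniteDimensional ℚ l.spechtModule :=
  inferInstanceAs (FiniteDimensional ℚ (l.spechtModule.restrictScalars ℚ))

/-- By semisimplicity the left ideal of the Young symmetrizer c is generated by an idempotent e = y
c, and c e = c. This replaces the relation c² = κ c and the computation of κ. -/
theorem exists_mul_youngSymmetrizer (l : Par) :
    ∃ y, l.youngSymmetrizer * y * l.youngSymmetrizer = l.youngSymmetrizer := by
  obtain ⟨e, he, hI⟩ := IsSemisimpleRing.ideal_eq_span_idempotent (Ideal.span {l.youngSymmetrizer})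
  have h1 : e ∈ Ideal.span {l.youngSymmetrizer} := hI ▸ Ideal.subset_span rfl
  have h2 : l.youngSymmetrizer ∈ Ideal.span {e} := hI ▸ Ideal.subset_span rfl
  obtain ⟨y, hy⟩ := Ideal.mem_span_singleton'.1 h1
  obtain ⟨x, hx⟩ := Ideal.mem_span_singleton'.1 h2
  refine ⟨y, ?_⟩
  rw [mul_assoc, hy]
  conv_lhs => rw [← hx, mul_assoc, he.eq, hx]

/-! ### Intertwining maps between Specht modules -/

section

variable {n : ℕ} {a b : n.Partition}

theorem intertwiningMap_smul
    (f : Representation.IntertwiningMap (spechtRep ⟨n, a⟩) (spechtRep ⟨n, b⟩))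
    (x : MonoidAlgebra ℚ (Perm (Fin n))) (v : spechtModule ⟨n, a⟩) : f (x • v) = x • f v := by
  induction x using MonoidAlgebra.induction_on with
  | of g =>
    have := f.isIntertwining _ _ g v
    rwa [spechtRep_apply, spechtRep_apply] at this
  | add x y hx hy => rw [add_smul, map_add, hx, hy, add_smul]
  | smul r x hx => rw [smul_assoc, map_smul, hx, smul_assoc]

/-- The Young symmetrizer as an element of the Specht module. -/
def spechtGen (l : Par) : l.spechtModule :=
  ⟨l.youngSymmetrizer, Submodule.mem_span_singleton_self _⟩

theorem exists_smul_spechtGen (l : Par) (v : l.spechtModule) :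
    ∃ x : MonoidAlgebra ℚ (Perm (Fin l.1)), v = x • l.spechtGen := by
  obtain ⟨x, hx⟩ := Submodule.mem_span_singleton.1 v.2
  exact ⟨x, Subtype.ext hx.symm⟩

/-- With c_a y c_a = c_a, an intertwining map satisfies f(c_a) = c_a y f(c_a), and f(c_a) is a left
multiple of c_b. -/
theorem exists_intertwiningMap_spechtGen
    (f : Representation.IntertwiningMap (spechtRep ⟨n, a⟩) (spechtRep ⟨n, b⟩)) :
    ∃ x, (f (spechtGen ⟨n, a⟩)).1 =
      youngSymmetrizer ⟨n, a⟩ * x * youngSymmetrizer ⟨n, b⟩ := by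
  obtain ⟨y, hy⟩ := exists_mul_youngSymmetrizer ⟨n, a⟩
  obtain ⟨x, hx⟩ := exists_smul_spechtGen ⟨n, b⟩ (f (spechtGen ⟨n, a⟩))
  have h1 : spechtGen ⟨n, a⟩ = (youngSymmetrizer ⟨n, a⟩ * y) • spechtGen ⟨n, a⟩ :=
    Subtype.ext hy.symm
  refine ⟨y * x, ?_⟩
  rw [h1, intertwiningMap_smul, hx, smul_smul, mul_assoc, ← mul_assoc]
  rfl

/-- The image of the generator has the form c_a x c_b, which contains a vanishing product (row sum
of a) · (column sum of b). -/
theorem finrank_intertwiningMap_of_ne (hne : a ≠ b)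
    (hab : ∑ i, rowIdx ⟨n, a⟩ i ≤ ∑ i, rowIdx ⟨n, b⟩ i) :
    Module.finrank ℚ (Representation.IntertwiningMap (spechtRep ⟨n, a⟩) (spechtRep ⟨n, b⟩)) = 0 := by
  have : Subsingleton (Representation.IntertwiningMap (spechtRep ⟨n, a⟩) (spechtRep ⟨n, b⟩)) := by
    refine subsingleton_of_forall_eq 0 fun f => ?_
    obtain ⟨x, hx⟩ := exists_intertwiningMap_spechtGen f
    refine DFunLike.ext _ _ fun v => ?_
    obtain ⟨z, rfl⟩ := exists_smul_spechtGen _ v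
    rw [intertwiningMap_smul]
    have h0 : f (spechtGen ⟨n, a⟩) = 0 := by
      refine Subtype.ext (hx.trans ?_)
      change _ = (0 : MonoidAlgebra ℚ (Perm (Fin n)))
      have := rowSum_mul_mul_colSum_eq_zero hne hab (colSum ⟨n, a⟩ * x * rowSum ⟨n, b⟩)
      simpa only [youngSymmetrizer_eq, mul_assoc] using this
    rw [h0, smul_zero]
    rfl
  exact Module.finrank_zero_of_subsingleton

/-- The image of the generator has the form c_a x c_a, a scalar multiple of c_a, so every
endomorphism is a multiple of the identity. -/
theorem finrank_intertwiningMap_self :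
    Module.finrank ℚ (Representation.IntertwiningMap (spechtRep ⟨n, a⟩) (spechtRep ⟨n, a⟩)) = 1 := by
  let e : Representation.IntertwiningMap (spechtRep ⟨n, a⟩) (spechtRep ⟨n, a⟩) :=
    LinearMap.intertwiningMap_of_isIntertwiningMap _ _ LinearMap.id fun _ _ => rfl
  have he : ∀ v, e v = v := fun _ => rfl
  refine finrank_eq_one e (fun h => youngSymmetrizer_ne_zero ⟨n, a⟩ ?_) fun f => ?_
  · have := DFunLike.congr_fun h (spechtGen ⟨n, a⟩)
    rw [he] at this
    exact congrArg Subtype.val this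
  · obtain ⟨x, hx⟩ := exists_intertwiningMap_spechtGen f
    obtain ⟨c, hc⟩ := exists_rowSum_mul_mul_colSum (a := a) (colSum ⟨n, a⟩ * x * rowSum ⟨n, a⟩)
    refine ⟨c, DFunLike.ext _ _ fun v => ?_⟩
    obtain ⟨z, rfl⟩ := exists_smul_spechtGen _ v
    rw [intertwiningMap_smul, intertwiningMap_smul]
    congr 1
    refine Subtype.ext ?_
    rw [hx]
    refine Eq.trans ?_ (hc.symm.trans ?_)
    · rfl
    · simp only [youngSymmetrizer_eq, mul_assoc]

theorem inner_sCF_eq_finrank : CF.inner (sCF ⟨n, a⟩) (sCF ⟨n, b⟩) =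
    Module.finrank ℚ (Representation.IntertwiningMap (spechtRep ⟨n, b⟩) (spechtRep ⟨n, a⟩)) := by
  have : Invertible (Nat.card (Perm (Fin n)) : ℚ) :=
    invertibleOfNonzero (Nat.cast_ne_zero.2 Nat.card_pos.ne')
  rw [← Representation.card_inv_mul_sum_char_mul_char_eq_finrank, Nat.card_eq_fintype_card]
  rfl

theorem _root_.WreathPower.CF.inner_comm {G : Type*} [Group G] [Fintype G] (f f' : CF G) :
    CF.inner f f' = CF.inner f' f := by
  unfold CF.inner
  congr 1
  refine Fintype.sum_equiv (Equiv.inv G) _ _ fun g => ?_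
  simp [mul_comm]

open Classical in
theorem inner_sCF : CF.inner (sCF ⟨n, a⟩) (sCF ⟨n, b⟩) = if a = b then 1 else 0 := by
  split_ifs with h
  · subst h
    rw [inner_sCF_eq_finrank, finrank_intertwiningMap_self, Nat.cast_one]
  -- The vanishing result covers only maps in one direction; symmetry of the scalar product supplies
  -- the other.
  · rcases le_total (∑ i, rowIdx ⟨n, a⟩ i) (∑ i, rowIdx ⟨n, b⟩ i) with hab | hab
    · rw [CF.inner_comm, inner_sCF_eq_finrank, finrank_intertwiningMap_of_ne h hab, Nat.cast_zero]
    · rw [inner_sCF_eq_finrank, finrank_intertwiningMap_of_ne (Ne.symm h) hab, Nat.cast_zero]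

end

end Par
end WreathPower
end

noncomputable section

namespace WreathPower

open Equiv
open scoped DirectSum

/-! ### Cycle types -/

section CycleType

variable {α β : Type*} [Fintype α] [DecidableEq α] [Fintype β] [DecidableEq β]

theorem cycleType_eq_of_injective (ι : α → β) (hι : Function.Injective ι) (g : Perm α) (G : Perm β)
    (h1 : ∀ x, G (ι x) = ι (g x)) (h2 : ∀ y, y ∉ Set.range ι → G y = y) :
    G.cycleType = g.cycleType := by
  classical
  have : G = g.extendDomain (Equiv.ofInjective ι hι) := by
    ext y
    by_cases hy : y ∈ Set.range ι
    · obtain ⟨x, rfl⟩ := hy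
      have := g.extendDomain_apply_image (Equiv.ofInjective ι hι) x
      rw [Equiv.ofInjective_apply, Equiv.ofInjective_apply] at this
      rw [h1, this]
    · rw [h2 y hy, Perm.extendDomain_apply_not_subtype _ _ hy]
  rw [this, Perm.cycleType_extendDomain]

theorem parts_partition_eq (g : Perm α) : g.partition.parts =
    g.cycleType + Multiset.replicate (Fintype.card α - g.cycleType.sum) 1 := by
  rw [Perm.parts_partition, Perm.sum_cycleType]

theorem cycleType_permCongrHom (e : α ≃ β) (g : Perm α) :
    (e.permCongrHom g).cycleType = g.cycleType :=
  cycleType_eq_of_injective e e.injective _ _ (fun x => by simp [permCongrHom, permCongr_apply])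
    fun y hy => (hy (e.surjective y)).elim

theorem cycleType_youngHom {m n : ℕ} (x : Perm (Fin m) × Perm (Fin n)) :
    (youngHom m n x).cycleType = x.1.cycleType + x.2.cycleType := by
  have hx : x = (x.1, 1) * (1, x.2) := by simp
  conv_lhs => rw [hx, map_mul]
  have hl : ∀ (y : Perm (Fin m)) (i : Fin n),
      youngHom m n (y, 1) (Fin.natAdd m i) = Fin.natAdd m i := fun y i => by
    rw [youngHom_natAdd]; rfl
  have hr : ∀ (y : Perm (Fin n)) (i : Fin m),
      youngHom m n (1, y) (Fin.castAdd n i) = Fin.castAdd n i := fun y i => by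
    rw [youngHom_castAdd]; rfl
  have hd : Perm.Disjoint (youngHom m n (x.1, 1)) (youngHom m n (1, x.2)) := fun i => by
    induction i using Fin.addCases with
    | left i => exact Or.inr (hr _ i)
    | right i => exact Or.inl (hl _ i)
  rw [hd.cycleType_mul]
  congr 1
  · refine cycleType_eq_of_injective (Fin.castAdd n) (Fin.castAdd_injective m n) _ _
      (fun i => youngHom_castAdd _ i) fun i hi => ?_
    induction i using Fin.addCases with
    | left i => exact (hi ⟨i, rfl⟩).elim
    | right i => exact hl _ i
  · refine cycleType_eq_of_injective (Fin.natAdd m) (Fin.natAdd_injective n m) _ _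
      (fun i => youngHom_natAdd _ i) fun i hi => ?_
    induction i using Fin.addCases with
    | left i => exact hr _ i
    | right i => exact (hi ⟨i, rfl⟩).elim

theorem parts_partition_youngHom {m n : ℕ} (x : Perm (Fin m) × Perm (Fin n)) :
    (youngHom m n x).partition.parts = x.1.partition.parts + x.2.partition.parts := by
  have h1 := x.1.sum_cycleType_le
  have h2 := x.2.sum_cycleType_le
  simp only [Fintype.card_fin] at h1 h2
  rw [parts_partition_eq, parts_partition_eq, parts_partition_eq, cycleType_youngHom,
    add_add_add_comm, ← Multiset.replicate_add, Multiset.sum_add]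
  simp only [Fintype.card_fin]
  congr 2
  omega

theorem cycleType_sigmaCongrRightHom {ι : Type*} [Fintype ι] [DecidableEq ι] {γ : ι → Type*}
    [∀ i, Fintype (γ i)] [∀ i, DecidableEq (γ i)] (F : ∀ i, Perm (γ i)) :
    (Perm.sigmaCongrRightHom γ F).cycleType = ∑ i, (F i).cycleType := by
  -- The induction splits off one factor at a time, so it runs over families that are trivial
  -- outside a finite set.
  suffices h : ∀ s : Finset ι, ∀ F : ∀ i, Perm (γ i), (∀ i, i ∉ s → F i = 1) →
      (Perm.sigmaCongrRightHom γ F).cycleType = ∑ i ∈ s, (F i).cycleType from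
    h Finset.univ F fun i hi => (hi (Finset.mem_univ i)).elim
  intro s
  induction s using Finset.induction_on with
  | empty =>
    intro F hF
    have : F = 1 := funext fun i => hF i (Finset.notMem_empty i)
    rw [this, map_one, Perm.cycleType_one, Finset.sum_empty]
  | insert j s hj ih =>
    intro F hF
    have h1 : F = Pi.mulSingle j (F j) * Function.update F j 1 := by
      funext i
      by_cases hi : i = j
      · subst hi; simp
      · simp [hi]
    have hs : ∀ (x : Σ i, γ i), x.1 ≠ j → Perm.sigmaCongrRightHom γ (Pi.mulSingle j (F j)) x = x := by
      rintro ⟨i, x⟩ hi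
      refine Sigma.ext rfl (heq_of_eq ?_)
      change (Pi.mulSingle j (F j) : ∀ i, Perm (γ i)) i x = x
      rw [Pi.mulSingle_eq_of_ne hi]; rfl
    have hd : Perm.Disjoint (Perm.sigmaCongrRightHom γ (Pi.mulSingle j (F j)))
        (Perm.sigmaCongrRightHom γ (Function.update F j 1)) := by
      rintro ⟨i, x⟩
      by_cases hi : i = j
      · subst hi
        refine Or.inr (Sigma.ext rfl (heq_of_eq ?_))
        change (Function.update F i 1 : ∀ i, Perm (γ i)) i x = x
        rw [Function.update_self]; rfl
      · exact Or.inl (hs _ hi)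
    rw [Finset.sum_insert hj]
    conv_lhs => rw [h1, map_mul]
    rw [hd.cycleType_mul]
    congr 1
    · refine cycleType_eq_of_injective (fun x : γ j => (⟨j, x⟩ : Σ i, γ i)) sigma_mk_injective _ _
        (fun x => ?_) fun x hx => hs x fun h => hx ?_
      · refine Sigma.ext rfl (heq_of_eq ?_)
        change (Pi.mulSingle j (F j) : ∀ i, Perm (γ i)) j x = F j x
        rw [Pi.mulSingle_eq_same]
      · obtain ⟨i, x⟩ := x
        subst h
        exact ⟨x, rfl⟩
    · rw [ih]
      · refine Finset.sum_congr rfl fun i hi => ?_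
        rw [Function.update_of_ne (by rintro rfl; exact hj hi)]
      · intro i hi
        by_cases hij : i = j
        · subst hij; simp
        · rw [Function.update_of_ne hij, hF i (by simp [hij, hi])]

/-- The embedding of `∏ i, S_{n i}` as a Young subgroup of the symmetric group on `N` letters, given
a bijection `⨆ i, {1, …, n i} ≃ {1, …, N}`. -/
def youngPiHom {ι : Type*} {n : ι → ℕ} {N : ℕ} (e : (Σ i, Fin (n i)) ≃ Fin N) :
    (∀ i, Perm (Fin (n i))) →* Perm (Fin N) :=
  e.permCongrHom.toMonoidHom.comp (Perm.sigmaCongrRightHom _)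

/-- Nontrivial cycles add up over the blocks; the numbers of fixed points then add up because N = ∑
n i. -/
theorem parts_partition_youngPiHom {ι : Type*} [Fintype ι] {n : ι → ℕ} {N : ℕ}
    (e : (Σ i, Fin (n i)) ≃ Fin N) (F : ∀ i, Perm (Fin (n i))) :
    (youngPiHom e F).partition.parts = ∑ i, (F i).partition.parts := by
  classical
  have hN : N = ∑ i, n i := by
    simpa using (Fintype.card_congr e).symm
  have hc : (youngPiHom e F).cycleType = ∑ i, (F i).cycleType := by
    rw [← cycleType_sigmaCongrRightHom]
    exact cycleType_permCongrHom e _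
  have hrep : ∀ (s : Finset ι) (f : ι → ℕ), Multiset.replicate (∑ i ∈ s, f i) 1 =
      ∑ i ∈ s, Multiset.replicate (f i) 1 := fun s f =>
    map_sum (Multiset.replicateAddMonoidHom 1) f s
  simp only [parts_partition_eq, hc, Finset.sum_add_distrib, ← hrep, Fintype.card_fin]
  congr 2
  have hs : (∑ i, (F i).cycleType).sum = ∑ i, (F i).cycleType.sum :=
    map_sum Multiset.sumAddMonoidHom _ _
  rw [hs, hN, Finset.sum_tsub_distrib]
  exact fun i _ => by simpa using (F i).sum_cycleType_le

end CycleType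

/-! ### The monoid of partitions and the sizes of conjugacy classes -/

namespace Par

/-- The size is the sum of the parts, so identities between elements of `Par` can be checked on
multisets, without dependent equalities. -/
theorem parts_injective : Function.Injective parts := by
  rintro ⟨m, a⟩ ⟨n, b⟩ h
  have h' : a.parts = b.parts := h
  obtain rfl : m = n := by rw [← a.parts_sum, ← b.parts_sum, h']
  rw [Nat.Partition.ext h']

theorem sum_parts (l : Par) : l.parts.sum = l.1 := l.2.parts_sum

instance : Add Par := ⟨fun l m => ⟨l.1 + m.1, ⟨l.parts + m.parts, fun h =>
  (Multiset.mem_add.1 h).elim l.2.parts_pos m.2.parts_pos, by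
    rw [Multiset.sum_add, sum_parts, sum_parts]⟩⟩⟩

instance : Zero Par := ⟨⟨0, ⟨0, fun h => (Multiset.notMem_zero _ h).elim, rfl⟩⟩⟩

theorem parts_add (l m : Par) : (l + m).parts = l.parts + m.parts := rfl

theorem parts_zero : (0 : Par).parts = 0 := rfl

instance : AddCommMonoid Par where
  add_assoc l m k := parts_injective (by simp only [parts_add, add_assoc])
  zero_add l := parts_injective (by simp only [parts_add, parts_zero, zero_add])
  add_zero l := parts_injective (by simp only [parts_add, parts_zero, add_zero])
  add_comm l m := parts_injective (by simp only [parts_add, add_comm])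
  nsmul := nsmulRec

/-- The multiset of parts, as an additive map. -/
def partsHom : Par →+ Multiset ℕ where
  toFun := parts
  map_zero' := rfl
  map_add' _ _ := rfl

theorem parts_sum {ι : Type*} (s : Finset ι) (f : ι → Par) :
    (∑ i ∈ s, f i).parts = ∑ i ∈ s, (f i).parts := map_sum partsHom f s

theorem z_eq_prod (l : Par) (s : Finset ℕ) (hs : l.parts.toFinset ⊆ s) :
    l.z = ∏ i ∈ s, i ^ l.parts.count i * (l.parts.count i).factorial := by
  refine Finset.prod_subset hs fun i _ hi => ?_
  rw [Multiset.count_eq_zero.2 fun h => hi (Multiset.mem_toFinset.2 h)]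
  simp

theorem z_pos (l : Par) : 0 < l.z :=
  Finset.prod_pos fun _ hi => Nat.mul_pos (Nat.pow_pos (l.2.parts_pos (Multiset.mem_toFinset.1 hi)))
    (Nat.factorial_pos _)

theorem z_ne_zero (l : Par) : (l.z : ℚ) ≠ 0 := Nat.cast_ne_zero.2 l.z_pos.ne'

/-- The class of cycle type λ has n!/z_λ elements; stated as a product to stay in ℕ. -/
theorem card_partition_eq (l : Par) :
    (Finset.univ.filter fun g : Perm (Fin l.1) => g.partition.parts = l.parts).card * l.z =
      l.1.factorial := by
  -- `Equiv.Perm.cycleType` omits fixed points, so the k parts equal to 1 are split off; they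
  -- contribute 1^k k! to z.
  set m := l.parts.filter (2 ≤ ·) with hm
  have hone : l.parts.filter (¬ 2 ≤ ·) = Multiset.replicate (l.parts.filter (¬ 2 ≤ ·)).card 1 :=
    Multiset.eq_replicate_card.2 fun x hx => by
      have h1 := l.2.parts_pos (Multiset.mem_filter.1 hx).1
      have h2 := (Multiset.mem_filter.1 hx).2
      omega
  set k := (l.parts.filter (¬ 2 ≤ ·)).card
  have hl : l.parts = m + Multiset.replicate k 1 := by
    rw [← hone, Multiset.filter_add_not]
  have hk : m.sum + k = l.1 := by
    have := congrArg Multiset.sum hl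
    rw [sum_parts, Multiset.sum_add, Multiset.sum_replicate, smul_eq_mul, mul_one] at this
    exact this.symm
  have h1m : 1 ∉ m := fun h => by have := (Multiset.mem_filter.1 h).2; omega
  have h := Perm.card_of_cycleType_mul_eq (Fin l.1) m
  rw [if_pos ⟨by rw [Fintype.card_fin]; omega, fun a ha => (Multiset.mem_filter.1 ha).2⟩,
    Fintype.card_fin] at h
  rw [← h]
  congr 1
  · congr 1
    refine Finset.filter_congr fun g _ => ⟨fun e => ?_, fun e => ?_⟩
    · rw [← Perm.filter_parts_partition_eq_cycleType, e]
    · rw [parts_partition_eq, e, hl, Fintype.card_fin]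
      congr 2; omega
  · have hsub : l.parts.toFinset ⊆ insert 1 m.toFinset := fun x hx => by
      rw [hl, Multiset.mem_toFinset, Multiset.mem_add] at hx
      rcases hx with hx | hx
      · exact Finset.mem_insert_of_mem (Multiset.mem_toFinset.2 hx)
      · rw [Multiset.eq_of_mem_replicate hx]; exact Finset.mem_insert_self _ _
    have hcount : ∀ i ∈ m.toFinset, l.parts.count i = m.count i := fun i hi => by
      rw [hl, Multiset.count_add, Multiset.count_replicate, if_neg, add_zero]
      rintro rfl
      exact h1m (Multiset.mem_toFinset.1 hi)
    rw [z_eq_prod l _ hsub, Finset.prod_insert (fun h => h1m (Multiset.mem_toFinset.1 h)),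
      Finset.prod_congr rfl fun i hi => by rw [hcount i hi], Finset.prod_mul_distrib,
      ← Finset.prod_multiset_count, hl, Multiset.count_add, Multiset.count_eq_zero.2 h1m,
      Multiset.count_replicate_self, one_pow, one_mul, zero_add, mul_assoc]
    congr 2
    omega

theorem exists_perm_parts (l : Par) : ∃ g : Perm (Fin l.1), g.partition.parts = l.parts := by
  by_contra! h
  have := l.card_partition_eq
  rw [Finset.filter_eq_empty_iff.2 fun g _ => h g, Finset.card_empty, zero_mul] at this
  exact (Nat.factorial_pos _).ne this

theorem _root_.WreathPower.CF.apply_eq_of_parts_eq {n : ℕ} (f : SymCF n) {g h : Perm (Fin n)}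
    (hgh : g.partition.parts = h.partition.parts) : f.1 g = f.1 h := by
  obtain ⟨x, rfl⟩ := isConj_iff.1 (Perm.partition_eq_of_isConj.2 (Nat.Partition.ext hgh))
  exact (f.2 x g).symm

end Par
end WreathPower
end

noncomputable section

namespace WreathPower

open Equiv
open scoped DirectSum

/-! ### Products of power sums and scalar products with them -/

/-- This is Frobenius reciprocity against the trivial character; it fixes the scalar in
`mul_ptildeCF`. -/
theorem CF.sum_ind {G H : Type*} [Group G] [Group H] [Fintype G] [Fintype H] (ι : H →* G)
    (f : CF H) : ∑ g, (CF.ind ι f).1 g =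
      (Fintype.card H : ℚ)⁻¹ * (Fintype.card G * ∑ h, f.1 h) := by
  classical
  simp only [CF.ind]
  rw [← Finset.mul_sum, Finset.sum_comm]
  congr 1
  have : ∀ x : G, (∑ g : G, ∑ h : H, if ι h = x⁻¹ * g * x then f.1 h else 0) = ∑ h, f.1 h := by
    intro x
    rw [Finset.sum_comm]
    refine Finset.sum_congr rfl fun h _ => ?_
    have : ∀ g, ι h = x⁻¹ * g * x ↔ g = x * ι h * x⁻¹ := fun g =>
      ⟨fun e => by rw [e]; group, fun e => by rw [e]; group⟩
    simp [this]
  rw [Finset.sum_congr rfl fun x _ => this x, Finset.sum_const, Finset.card_univ, nsmul_eq_mul]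

namespace Par

theorem ptildeCF_apply (l : Par) (g : Perm (Fin l.1)) :
    l.ptildeCF.1 g = if g.partition.parts = l.parts then 1 else 0 := rfl

theorem sum_ptildeCF (l : Par) : ∑ g, l.ptildeCF.1 g = l.1.factorial / l.z := by
  simp only [ptildeCF_apply]
  rw [Finset.sum_boole, eq_div_iff l.z_ne_zero]
  exact_mod_cast l.card_partition_eq

theorem eq_smul_ptildeCF (l : Par) (f : SymCF l.1)
    (hf : ∀ g, g.partition.parts ≠ l.parts → f.1 g = 0) :
    f = ((∑ g, f.1 g) * l.z / l.1.factorial) • l.ptildeCF := by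
  obtain ⟨g₀, hg₀⟩ := l.exists_perm_parts
  have h : f = f.1 g₀ • l.ptildeCF := by
    ext g
    change f.1 g = f.1 g₀ * l.ptildeCF.1 g
    rw [ptildeCF_apply]
    split_ifs with h
    · rw [mul_one]
      exact CF.apply_eq_of_parts_eq f (h.trans hg₀.symm)
    · rw [mul_zero, hf g h]
  have hs : ∑ g, f.1 g = f.1 g₀ * (l.1.factorial / l.z) := by
    rw [← sum_ptildeCF, Finset.mul_sum]
    conv_lhs => rw [h]
    rfl
  have h1 := l.z_ne_zero
  have h2 : (l.1.factorial : ℚ) ≠ 0 := Nat.cast_ne_zero.2 (Nat.factorial_ne_zero _)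
  rw [hs]
  conv_lhs => rw [h]
  congr 1
  field_simp

/-- The multiple `c • p_l` of a power sum. -/
def cp (c : ℚ) (l : Par) : Lam := Lam.of ((c * l.z) • l.ptildeCF)

theorem p_eq_cp (l : Par) : l.p = cp 1 l := by rw [cp, one_mul]; rfl

theorem ptilde_eq_cp (l : Par) : l.ptilde = cp (l.z : ℚ)⁻¹ l := by
  rw [cp, inv_mul_cancel₀ l.z_ne_zero, one_smul]; rfl

/-- This is p_λ p_μ = p_{λ+μ} with scalars. The induced function lives on the class of type λ+μ,
hence is a multiple of p̃_{λ+μ}, and the multiple is read off from the total sums. -/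
theorem mul_ptildeCF (c d : ℚ) (l m : Par) :
    SymCF.mul ((c * l.z) • l.ptildeCF) ((d * m.z) • m.ptildeCF) =
      (c * d * (l + m).z) • (l + m).ptildeCF := by
  refine (eq_smul_ptildeCF (l + m) _ fun g hg => ?_).trans ?_
  · refine mul_eq_zero_of_right _ (Finset.sum_eq_zero fun x _ => Finset.sum_eq_zero fun h _ => ?_)
    split_ifs with e
    · change c * l.z * l.ptildeCF.1 h.1 * (d * m.z * m.ptildeCF.1 h.2) = 0
      rw [ptildeCF_apply, ptildeCF_apply]
      split_ifs with h1 h2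
      · refine (hg ?_).elim
        have hc : IsConj (youngHom l.1 m.1 h) g := isConj_iff.2 ⟨x, by
          have : x * (x⁻¹ * g * x) * x⁻¹ = g := by group
          rw [← e] at this
          exact this⟩
        have := congrArg Nat.Partition.parts (Perm.partition_eq_of_isConj.1 hc)
        rw [← this, parts_partition_youngHom, h1, h2, parts_add]
      all_goals simp
    · rfl
  · congr 1
    have hs : ∑ x : Perm (Fin l.1) × Perm (Fin m.1),
        (CF.tensor ((c * l.z : ℚ) • l.ptildeCF) ((d * m.z : ℚ) • m.ptildeCF)).1 x =
        c * l.1.factorial * (d * m.1.factorial) := by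
      have h1 : ∀ (e : ℚ) (k : Par), ∑ x, (e * k.z * k.ptildeCF.1 x) = e * k.1.factorial := by
        intro e k
        have := k.z_ne_zero
        rw [← Finset.mul_sum, sum_ptildeCF]
        field_simp
      rw [← h1, ← h1, Fintype.sum_mul_sum, Fintype.sum_prod_type]
      rfl
    have e := CF.sum_ind (youngHom l.1 m.1)
      (CF.tensor ((c * l.z : ℚ) • l.ptildeCF) ((d * m.z : ℚ) • m.ptildeCF))
    rw [hs, Fintype.card_prod, Fintype.card_perm, Fintype.card_perm, Fintype.card_perm,
      Fintype.card_fin, Fintype.card_fin, Fintype.card_fin] at e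
    have h3 : ∀ k : ℕ, (k.factorial : ℚ) ≠ 0 := fun k => Nat.cast_ne_zero.2 (Nat.factorial_ne_zero _)
    have h1 := h3 l.1
    have h2 := h3 m.1
    have h4 := h3 (l.1 + m.1)
    change (∑ g, (CF.ind (youngHom l.1 m.1) _).1 g) * _ / ((l.1 + m.1).factorial : ℚ) = _
    rw [e]
    push_cast
    field_simp

theorem cp_mul_cp (c d : ℚ) (l m : Par) : cp c l * cp d m = cp (c * d) (l + m) := by
  rw [cp, cp, cp, ← mul_ptildeCF]
  exact DirectSum.of_mul_of _ _

theorem cp_one_zero : cp 1 0 = 1 := by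
  have : ((1 : ℚ) * (0 : Par).z) • (0 : Par).ptildeCF = SymCF.one := by
    have hz : (0 : Par).z = 1 := rfl
    rw [hz, Nat.cast_one, one_mul, one_smul]
    ext g
    rw [ptildeCF_apply, if_pos]
    · rfl
    · have : g = (1 : Perm (Fin 0)) := Subsingleton.elim (α := Perm (Fin 0)) _ _
      rw [this, parts_partition_eq, Perm.cycleType_one]
      rfl
  exact congrArg (DirectSum.of SymCF 0) this

theorem prod_cp {ι : Type*} (s : Finset ι) (c : ι → ℚ) (l : ι → Par) :
    ∏ i ∈ s, cp (c i) (l i) = cp (∏ i ∈ s, c i) (∑ i ∈ s, l i) := by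
  classical
  induction s using Finset.induction_on with
  | empty => rw [Finset.prod_empty, Finset.prod_empty, Finset.sum_empty, cp_one_zero]
  | insert i s hi ih =>
    rw [Finset.prod_insert hi, Finset.prod_insert hi, Finset.sum_insert hi, ih, cp_mul_cp]

/-! ### Scalar products with power sums and character values -/

theorem _root_.WreathPower.Lam.inner_of {n : ℕ} (f f' : SymCF n) :
    Lam.inner (Lam.of f) (Lam.of f') = CF.inner f f' := by
  rw [Lam.inner, finsum_eq_single _ n]
  · rw [Lam.of, Lam.of, DirectSum.of_eq_same, DirectSum.of_eq_same]
  · intro m hm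
    rw [Lam.of, DirectSum.of_eq_of_ne _ _ _ hm]
    simp [CF.inner]

theorem _root_.WreathPower.Lam.inner_of_of_ne {m n : ℕ} (h : m ≠ n) (f : SymCF m) (f' : SymCF n) :
    Lam.inner (Lam.of f) (Lam.of f') = 0 := by
  rw [Lam.inner]
  refine (finsum_congr fun k => ?_).trans finsum_zero
  by_cases hk : k = m
  · subst hk
    rw [Lam.of, Lam.of, DirectSum.of_eq_of_ne n k f' h]
    simp [CF.inner]
  · rw [Lam.of, DirectSum.of_eq_of_ne m k f hk]
    simp [CF.inner]

/-- The value of the irreducible character labelled by `l` on elements of cycle type `m`, or `0` if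
the sizes of `l` and `m` differ. -/
def X (l m : Par) : ℚ := Lam.inner l.s m.p

theorem X_eq_zero {l m : Par} (h : l.1 ≠ m.1) : X l m = 0 := Lam.inner_of_of_ne h _ _

/-- Pairing with a power sum is evaluation: the class has n!/z elements and is closed under
inversion. -/
theorem _root_.WreathPower.CF.inner_smul_ptildeCF {n : ℕ} (a : n.Partition) (f : SymCF n) (c : ℚ) {g : Perm (Fin n)}
    (hg : g.partition.parts = a.parts) :
    CF.inner f ((c * z ⟨n, a⟩) • ptildeCF ⟨n, a⟩) = c * f.1 g := by
  have h1 : ∀ x : Perm (Fin n), f.1 x * ((c * z ⟨n, a⟩) • ptildeCF ⟨n, a⟩).1 x⁻¹ =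
      c * z ⟨n, a⟩ * f.1 g * (ptildeCF ⟨n, a⟩).1 x := by
    intro x
    have hx : x⁻¹.partition.parts = x.partition.parts := by
      rw [parts_partition_eq, parts_partition_eq, Perm.cycleType_inv]
    change f.1 x * (c * z ⟨n, a⟩ * (ptildeCF ⟨n, a⟩).1 x⁻¹) = _
    rw [ptildeCF_apply, ptildeCF_apply, hx]
    split_ifs with h
    · have : f.1 x = f.1 g := CF.apply_eq_of_parts_eq f (h.trans hg.symm)
      rw [this]; ring
    · simp
  rw [CF.inner, Finset.sum_congr rfl fun x _ => h1 x, ← Finset.mul_sum, sum_ptildeCF ⟨n, a⟩,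
    Fintype.card_perm, Fintype.card_fin]
  have h2 := z_ne_zero ⟨n, a⟩
  have h3 : (n.factorial : ℚ) ≠ 0 := Nat.cast_ne_zero.2 (Nat.factorial_ne_zero _)
  field_simp

theorem X_eq_sCF (l m : Par) (g : Perm (Fin l.1)) (hg : g.partition.parts = m.parts) :
    X l m = l.sCF.1 g := by
  obtain ⟨n, a⟩ := l
  obtain ⟨k, b⟩ := m
  have hg' : g.partition.parts = b.parts := hg
  -- Equality of cycle types forces equality of sizes.
  obtain rfl : k = n := by
    have h : g.partition.parts.sum = n := g.partition.parts_sum.trans (Fintype.card_fin n)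
    exact (b.parts_sum.symm.trans (congrArg Multiset.sum hg'.symm)).trans h
  rw [X, p_eq_cp, s, cp, Lam.inner_of, CF.inner_smul_ptildeCF b _ _ hg, one_mul]

theorem inner_s_cp (c : ℚ) (l m : Par) : Lam.inner l.s (cp c m) = c * X l m := by
  obtain ⟨n, a⟩ := l
  obtain ⟨k, b⟩ := m
  by_cases h : n = k
  · subst h
    obtain ⟨g, hg⟩ := exists_perm_parts ⟨n, b⟩
    rw [X_eq_sCF ⟨n, a⟩ ⟨n, b⟩ g hg, s, cp, Lam.inner_of, CF.inner_smul_ptildeCF b _ _ hg]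
  · rw [X_eq_zero h, mul_zero]
    exact Lam.inner_of_of_ne h _ _

/-- The partitions of `n`, as a finite set of partitions. -/
def ofSize (n : ℕ) : Finset Par := Finset.univ.map (Function.Embedding.sigmaMk n)

theorem mem_ofSize {n : ℕ} {l : Par} : l ∈ ofSize n ↔ l.1 = n := by
  obtain ⟨m, a⟩ := l
  constructor
  · intro h
    obtain ⟨b, -, hb⟩ := Finset.mem_map.1 h
    exact (congrArg Sigma.fst hb).symm
  · rintro rfl
    exact Finset.mem_map.2 ⟨a, Finset.mem_univ _, rfl⟩

/-- The cycle type of a permutation. -/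
def cyc {n : ℕ} (g : Perm (Fin n)) : Par := ⟨_, g.partition⟩

theorem parts_cyc {n : ℕ} (g : Perm (Fin n)) : (cyc g).parts = g.partition.parts := rfl

theorem fst_cyc {n : ℕ} (g : Perm (Fin n)) : (cyc g).1 = n := Fintype.card_fin n

open Classical in
theorem card_cyc_eq {n : ℕ} {m : Par} (hm : m.1 = n) :
    ((Finset.univ.filter fun g : Perm (Fin n) => cyc g = m).card : ℚ) = n.factorial / m.z := by
  subst hm
  rw [eq_div_iff m.z_ne_zero, Finset.filter_congr fun g _ =>
    show cyc g = m ↔ g.partition.parts = m.parts from parts_injective.eq_iff.symm]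
  exact_mod_cast m.card_partition_eq

/-- Sums over a product of symmetric groups, for functions depending only on the cycle types. -/
theorem sum_cyc {ι : Type*} [Fintype ι] [DecidableEq ι] (n : ι → ℕ) (f : (ι → Par) → ℚ) :
    ∑ g : ∀ i, Perm (Fin (n i)), f (fun i => cyc (g i)) =
      (∏ i, ((n i).factorial : ℚ)) *
        ∑ m ∈ Fintype.piFinset fun i => ofSize (n i), f m / ∏ i, ((m i).z : ℚ) := by
  classical
  rw [← Finset.sum_fiberwise_of_maps_to (g := fun (g : ∀ i, Perm (Fin (n i))) i => cyc (g i))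
    (t := Fintype.piFinset fun i => ofSize (n i))
    fun g _ => Fintype.mem_piFinset.2 fun i => mem_ofSize.2 (fst_cyc _), Finset.mul_sum]
  refine Finset.sum_congr rfl fun m hm => ?_
  have h1 : (Finset.univ.filter fun g : ∀ i, Perm (Fin (n i)) => (fun i => cyc (g i)) = m) =
      Fintype.piFinset fun i => Finset.univ.filter fun g : Perm (Fin (n i)) => cyc g = m i := by
    ext g
    simp [funext_iff]
  rw [Finset.sum_congr rfl fun g hg => by rw [(Finset.mem_filter.1 hg).2], Finset.sum_const,
    nsmul_eq_mul, h1, Fintype.card_piFinset, Nat.cast_prod,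
    Finset.prod_congr rfl fun i _ => card_cyc_eq (mem_ofSize.1 (Fintype.mem_piFinset.1 hm i)),
    Finset.prod_div_distrib]
  ring

open Classical in
-- Orthonormality of the Specht characters, with the group sum collected by cycle type.
theorem sum_X_mul_X (l m : Par) : ∑ k ∈ ofSize l.1, X l k * X m k / k.z = if l = m then 1 else 0 := by
  obtain ⟨n, a⟩ := l
  obtain ⟨n', b⟩ := m
  by_cases h : n = n'
  · subst h
    have h1 := inner_sCF (a := a) (b := b)
    have h2 : ∀ g : Perm (Fin n), (sCF ⟨n, a⟩).1 g * (sCF ⟨n, b⟩).1 g⁻¹ =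
        X ⟨n, a⟩ (cyc g) * X ⟨n, b⟩ (cyc g) := by
      intro g
      have hi : (sCF ⟨n, b⟩).1 g⁻¹ = (sCF ⟨n, b⟩).1 g := CF.apply_eq_of_parts_eq _ (by
        rw [parts_partition_eq, parts_partition_eq, Perm.cycleType_inv])
      rw [hi, X_eq_sCF _ _ g rfl, X_eq_sCF _ _ g rfl]
    have h3 : ∑ g : Perm (Fin n), X ⟨n, a⟩ (cyc g) * X ⟨n, b⟩ (cyc g) =
        n.factorial * ∑ k ∈ ofSize n, X ⟨n, a⟩ k * X ⟨n, b⟩ k / k.z := by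
      rw [← Finset.sum_fiberwise_of_maps_to (g := fun g : Perm (Fin n) => cyc g)
        (t := ofSize n) fun g _ => mem_ofSize.2 (fst_cyc _), Finset.mul_sum]
      refine Finset.sum_congr rfl fun m hm => ?_
      rw [Finset.sum_congr rfl fun g hg => by rw [(Finset.mem_filter.1 hg).2], Finset.sum_const,
        nsmul_eq_mul, card_cyc_eq (mem_ofSize.1 hm)]
      ring
    rw [CF.inner, Finset.sum_congr rfl fun g _ => h2 g, h3, Fintype.card_perm,
      Fintype.card_fin, ← mul_assoc, inv_mul_cancel₀ (Nat.cast_ne_zero.2 (Nat.factorial_ne_zero _)),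
      one_mul] at h1
    rw [h1]
    simp [Sigma.ext_iff]
  · rw [if_neg fun e => h (congrArg Sigma.fst e)]
    refine Finset.sum_eq_zero fun k hk => ?_
    rw [X_eq_zero (l := ⟨n', b⟩) (m := k), mul_zero, zero_div]
    rw [mem_ofSize.1 hk]
    exact Ne.symm h

end Par

/-- Products of power sums are power sums of the joined partitions, so both scalar products become
character values; the p̃ factors leave the denominators z. -/
theorem wreath_s_apply {T Q : Type*} [Fintype T] [Fintype Q] (A : Matrix T Q ℚ) (l : PMap T)
    (m : PMap Q) : wreath A Par.s Par.s l m = ∑ᶠ ν : PMap (T × Q),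
      (∏ t, Par.X (l t) (∑ q, ν (t, q))) * (∏ q, Par.X (m q) (∑ t, ν (t, q))) *
        ∏ t, ∏ q, A t q ^ (ν (t, q)).length / (ν (t, q)).z := by
  refine finsum_congr fun ν => ?_
  simp only [Par.ptilde_eq_cp, Par.p_eq_cp, Par.prod_cp, Par.inner_s_cp, Finset.prod_const_one,
    one_mul, Finset.prod_mul_distrib, div_eq_mul_inv]
  ring

end WreathPower
end

noncomputable section

namespace WreathPower

open Equiv
open scoped DirectSum

/-! ### The algebra of formal combinations of partition-valued maps -/

namespace Par

/-- The partition of `k` with at most one part. -/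
def row (k : ℕ) : Par := ⟨k, Nat.Partition.indiscrete k⟩

theorem parts_row {k : ℕ} (hk : k ≠ 0) : (row k).parts = {k} := Nat.Partition.indiscrete_parts hk

theorem exists_eq_add_row {l : Par} {k : ℕ} (hk : k ∈ l.parts) : ∃ l', l = l' + row k := by
  have hk0 : k ≠ 0 := (l.2.parts_pos hk).ne'
  refine ⟨⟨_, ⟨l.parts.erase k, fun h => l.2.parts_pos (Multiset.mem_of_mem_erase h), rfl⟩⟩,
    parts_injective ?_⟩
  rw [parts_add, parts_row hk0]
  change _ = l.parts.erase k + {k}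
  rw [add_comm, Multiset.singleton_add, Multiset.cons_erase hk]

theorem add_right_cancel' {l m k : Par} (h : l + k = m + k) : l = m :=
  parts_injective (add_right_cancel (congrArg parts h))

theorem z_add_row (l : Par) {k : ℕ} (hk : k ≠ 0) :
    (l + row k).z = l.z * (k * (l + row k).parts.count k) := by
  have hp : (l + row k).parts = k ::ₘ l.parts := by
    rw [parts_add, parts_row hk, add_comm, Multiset.singleton_add]
  have hs : (l + row k).parts.toFinset ⊆ insert k l.parts.toFinset := by
    rw [hp, Multiset.toFinset_cons]
  rw [z_eq_prod l _ (Finset.subset_insert k _), z_eq_prod _ _ hs,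
    ← Finset.mul_prod_erase _ _ (Finset.mem_insert_self k _),
    ← Finset.mul_prod_erase _ (fun i => i ^ l.parts.count i * (l.parts.count i).factorial)
      (Finset.mem_insert_self k _), hp, Multiset.count_cons_self, pow_succ, Nat.factorial_succ,
    Finset.prod_congr rfl fun i hi => by rw [Multiset.count_cons_of_ne (Finset.ne_of_mem_erase hi)]]
  ring

theorem length_add (l m : Par) : (l + m).length = l.length + m.length := Multiset.card_add _ _

theorem length_row {k : ℕ} (hk : k ≠ 0) : (row k).length = 1 := by
  rw [length, parts_row hk, Multiset.card_singleton]

theorem eq_zero_of_add_eq_zero {l m : Par} (h : l + m = 0) : l = 0 := parts_injective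
  (add_eq_zero.1 (congrArg parts h)).1

end Par

namespace PMap

/-- The map with value the partition `(k)` at `s` and the empty partition elsewhere. -/
def row {S : Type*} [DecidableEq S] (s : S) (k : ℕ) : PMap S := Pi.single s (Par.row k)

/-- Maps with one part generate the monoid `PMap S`; the induction is on the total number of parts.
-/
theorem induction_row {S : Type*} [Fintype S] [DecidableEq S] {P : PMap S → Prop} (h0 : P 0)
    (hadd : ∀ σ s k, k ≠ 0 → P σ → P (σ + row s k)) (σ : PMap S) : P σ := by
  induction hn : ∑ s, (σ s).parts.card using Nat.strong_induction_on generalizing σ with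
  | _ n ih =>
    by_cases hσ : ∀ s, (σ s).parts = 0
    · have : σ = 0 := funext fun s => Par.parts_injective (hσ s)
      rwa [this]
    · push Not at hσ
      obtain ⟨s, hs⟩ := hσ
      obtain ⟨k, hk⟩ := Multiset.exists_mem_of_ne_zero hs
      have hk0 : k ≠ 0 := ((σ s).2.parts_pos hk).ne'
      obtain ⟨l, hl⟩ := Par.exists_eq_add_row hk
      have e : σ = Function.update σ s l + row s k := by
        funext s'
        by_cases h : s' = s
        · subst h
          rw [Pi.add_apply, Function.update_self, row, Pi.single_eq_same, hl]
        · rw [Pi.add_apply, Function.update_of_ne h, row, Pi.single_eq_of_ne h, add_zero]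
      rw [e]
      refine hadd _ s k hk0 (ih _ ?_ _ rfl)
      rw [← hn]
      refine Finset.sum_lt_sum (fun s' _ => ?_) ⟨s, Finset.mem_univ s, ?_⟩
      · by_cases h : s' = s
        · subst h
          rw [Function.update_self, hl, Par.parts_add, Multiset.card_add]
          exact Nat.le_add_right _ _
        · rw [Function.update_of_ne h]
      · rw [Function.update_self, hl, Par.parts_add, Multiset.card_add, Par.parts_row hk0,
          Multiset.card_singleton]
        exact Nat.lt_succ_self _

/-- The product of the numbers `z` of the values of a partition-valued map. -/
def z {S : Type*} [Fintype S] (σ : PMap S) : ℚ := ∏ s, ((σ s).z : ℚ)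

theorem z_ne_zero {S : Type*} [Fintype S] (σ : PMap S) : σ.z ≠ 0 :=
  Finset.prod_ne_zero_iff.2 fun s _ => (σ s).z_ne_zero

section

variable {T Q R : Type*} [Fintype T] [Fintype Q] [Fintype R]

/-- The map `t ↦ ∑ q, ν (t, q)`. -/
def rowSums : PMap (T × Q) →+ PMap T where
  toFun ν t := ∑ q, ν (t, q)
  map_zero' := funext fun _ => Finset.sum_const_zero
  map_add' _ _ := funext fun _ => Finset.sum_add_distrib

/-- The map `q ↦ ∑ t, ν (t, q)`. -/
def colSums : PMap (T × Q) →+ PMap Q where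
  toFun ν q := ∑ t, ν (t, q)
  map_zero' := funext fun _ => Finset.sum_const_zero
  map_add' _ _ := funext fun _ => Finset.sum_add_distrib

theorem rowSums_apply (ν : PMap (T × Q)) (t : T) : rowSums ν t = ∑ q, ν (t, q) := rfl

theorem colSums_apply (ν : PMap (T × Q)) (q : Q) : colSums ν q = ∑ t, ν (t, q) := rfl

/-- The weight `∏ A_{tq} ^ l(ν(t, q)) / z_ν(t, q)`. -/
def weight (A : Matrix T Q ℚ) (ν : PMap (T × Q)) : ℚ :=
  ∏ x : T × Q, A x.1 x.2 ^ (ν x).length / (ν x).z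

variable [DecidableEq T] [DecidableEq Q]

theorem rowSums_row (t : T) (q : Q) (k : ℕ) : rowSums (row (t, q) k) = row t k := by
  funext t'
  rw [rowSums_apply, row, row]
  by_cases h : t' = t
  · subst h
    rw [Finset.sum_eq_single q, Pi.single_eq_same, Pi.single_eq_same]
    · exact fun q' _ hq => Pi.single_eq_of_ne (fun e => hq (congrArg Prod.snd e)) _
    · simp
  · rw [Pi.single_eq_of_ne h]
    exact Finset.sum_eq_zero fun q' _ => Pi.single_eq_of_ne (fun e => h (congrArg Prod.fst e)) _

theorem colSums_row (t : T) (q : Q) (k : ℕ) : colSums (row (t, q) k) = row q k := by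
  funext q'
  rw [colSums_apply, row, row]
  by_cases h : q' = q
  · subst h
    rw [Finset.sum_eq_single t, Pi.single_eq_same, Pi.single_eq_same]
    · exact fun t' _ ht => Pi.single_eq_of_ne (fun e => ht (congrArg Prod.fst e)) _
    · simp
  · rw [Pi.single_eq_of_ne h]
    exact Finset.sum_eq_zero fun t' _ => Pi.single_eq_of_ne (fun e => h (congrArg Prod.snd e)) _

theorem z_add_row (σ : PMap Q) (q : Q) {k : ℕ} (hk : k ≠ 0) :
    (σ + row q k).z = σ.z * (k * ((σ + row q k) q).parts.count k) := by
  have hq : (σ + row q k) q = σ q + Par.row k := by rw [Pi.add_apply, row, Pi.single_eq_same]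
  rw [z, z, ← Finset.mul_prod_erase _ _ (Finset.mem_univ q),
    ← Finset.mul_prod_erase _ (fun s => ((σ s).z : ℚ)) (Finset.mem_univ q), hq, Par.z_add_row _ hk,
    Finset.prod_congr rfl fun i hi => by
      rw [Pi.add_apply, row, Pi.single_eq_of_ne (Finset.ne_of_mem_erase hi), add_zero]]
  push_cast
  ring

/-- The multiplicity stays as a factor on the left because in `coeff_splitHom` these multiplicities
are added over t. -/
theorem weight_add_row (A : Matrix T Q ℚ) (ν : PMap (T × Q)) (t : T) (q : Q) {k : ℕ} (hk : k ≠ 0) :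
    weight A (ν + row (t, q) k) * (k * ((ν + row (t, q) k) (t, q)).parts.count k) =
      A t q * weight A ν := by
  have hq : (ν + row (t, q) k) (t, q) = ν (t, q) + Par.row k := by
    rw [Pi.add_apply, row, Pi.single_eq_same]
  have hc : (ν (t, q) + Par.row k).parts.count k ≠ 0 := by
    rw [Par.parts_add, Multiset.count_add, Par.parts_row hk, Multiset.count_singleton_self]
    exact Nat.succ_ne_zero _
  rw [weight, weight, ← Finset.mul_prod_erase _ _ (Finset.mem_univ (t, q)),
    ← Finset.mul_prod_erase _ (fun x => A x.1 x.2 ^ (ν x).length / (ν x).z)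
      (Finset.mem_univ (t, q)), hq, Par.z_add_row _ hk, Par.length_add, Par.length_row hk,
    Finset.prod_congr rfl fun i hi => by
      rw [Pi.add_apply, row, Pi.single_eq_of_ne (Finset.ne_of_mem_erase hi), add_zero]]
  have h1 := (ν (t, q)).z_ne_zero
  have h2 : (k : ℚ) ≠ 0 := Nat.cast_ne_zero.2 hk
  have h3 : (((ν (t, q) + Par.row k).parts.count k : ℕ) : ℚ) ≠ 0 := Nat.cast_ne_zero.2 hc
  push_cast
  field_simp
  ring

end

end PMap

/-- The formal rational combinations of partition-valued maps, with the product that extends the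
sum of partition-valued maps. It is a polynomial ring on the maps with one part. -/
abbrev PAlg (T : Type*) : Type _ := AddMonoidAlgebra ℚ (PMap T)

/-! ### Substitution homomorphisms attached to matrices -/

section

variable {T Q R : Type*} [Fintype T] [Fintype Q] [Fintype R] [DecidableEq T] [DecidableEq Q]
  [DecidableEq R]

open AddMonoidAlgebra (single)

/-- The multiplicative map that replaces every part `k` at `q` by `∑ t, A_{tq} (k at (t, q))`. -/
def splitMon (A : Matrix T Q ℚ) : Multiplicative (PMap Q) →* PAlg (T × Q) where
  toFun σ := ∏ q, ((σ.toAdd q).parts.map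
    fun k => ∑ t, single (PMap.row (t, q) k : PMap (T × Q)) (A t q)).prod
  map_one' := Finset.prod_eq_one fun q _ => by
    rw [toAdd_one, Pi.zero_apply, Par.parts_zero, Multiset.map_zero, Multiset.prod_zero]
  map_mul' σ τ := by
    rw [← Finset.prod_mul_distrib]
    refine Finset.prod_congr rfl fun q _ => ?_
    rw [toAdd_mul, Pi.add_apply, Par.parts_add, Multiset.map_add, Multiset.prod_add]

/-- The algebra homomorphism that replaces every part `k` at `q` by
`∑ t, A_{tq} (k at (t, q))`. -/
def splitHom (A : Matrix T Q ℚ) : PAlg Q →ₐ[ℚ] PAlg (T × Q) :=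
  AddMonoidAlgebra.lift ℚ (PAlg (T × Q)) (PMap Q) (splitMon A)

theorem splitHom_row (A : Matrix T Q ℚ) (q : Q) {k : ℕ} (hk : k ≠ 0) :
    splitHom A (single (PMap.row q k) 1) = ∑ t, single (PMap.row (t, q) k) (A t q) := by
  rw [splitHom, AddMonoidAlgebra.lift_single, one_smul]
  change ∏ q', (((PMap.row q k : PMap Q) q').parts.map
    fun k => ∑ t, single (PMap.row (t, q') k : PMap (T × Q)) (A t q')).prod = _
  rw [Finset.prod_eq_single q]
  · rw [PMap.row, Pi.single_eq_same, Par.parts_row hk, Multiset.map_singleton,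
      Multiset.prod_singleton]
  · intro q' _ h
    rw [PMap.row, Pi.single_eq_of_ne h, Par.parts_zero, Multiset.map_zero, Multiset.prod_zero]
  · simp

/-- The algebra homomorphism that replaces every part `k` at `q` by `∑ t, A_{tq} (k at t)`. -/
def substHom (A : Matrix T Q ℚ) : PAlg Q →ₐ[ℚ] PAlg T :=
  (AddMonoidAlgebra.mapDomainAlgHom ℚ ℚ PMap.rowSums).comp (splitHom A)

theorem substHom_apply (A : Matrix T Q ℚ) (x : PAlg Q) :
    substHom A x = AddMonoidAlgebra.mapDomain PMap.rowSums (splitHom A x) := rfl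

theorem substHom_row (A : Matrix T Q ℚ) (q : Q) {k : ℕ} (hk : k ≠ 0) :
    substHom A (single (PMap.row q k) 1) = ∑ t, single (PMap.row t k) (A t q) := by
  have : substHom A (single (PMap.row q k) 1) =
    AddMonoidAlgebra.mapDomainAlgHom ℚ ℚ PMap.rowSums (splitHom A (single (PMap.row q k) 1)) := rfl
  rw [this, splitHom_row A q hk, map_sum]
  refine Finset.sum_congr rfl fun t _ => ?_
  rw [← PMap.rowSums_row t q k]
  exact AddMonoidAlgebra.mapDomain_single

theorem substHom_single_row (A : Matrix T Q ℚ) (q : Q) {k : ℕ} (hk : k ≠ 0) (c : ℚ) :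
    substHom A (single (PMap.row q k) c) = ∑ t, single (PMap.row t k) (c * A t q) := by
  have : (single (PMap.row q k) c : PAlg Q) = c • single (PMap.row q k) 1 := by
    rw [AddMonoidAlgebra.smul_single, smul_eq_mul, mul_one]
  rw [this, map_smul, substHom_row A q hk, Finset.smul_sum]
  exact Finset.sum_congr rfl fun t _ => by rw [AddMonoidAlgebra.smul_single, smul_eq_mul]

theorem single_add_row (σ : PMap Q) (q : Q) (k : ℕ) :
    (single (σ + PMap.row q k) 1 : PAlg Q) = single σ 1 * single (PMap.row q k) 1 := by
  rw [AddMonoidAlgebra.single_mul_single, one_mul]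

theorem algHom_ext_row {B : Type*} [Semiring B] [Algebra ℚ B] {f g : PAlg Q →ₐ[ℚ] B}
    (h : ∀ q k, k ≠ 0 → f (single (PMap.row q k) 1) = g (single (PMap.row q k) 1)) : f = g := by
  refine AddMonoidAlgebra.algHom_ext (fun σ => ?_) ?_
  · induction σ using PMap.induction_row with
    | h0 => exact (map_one f).trans (map_one g).symm
    | hadd σ q k hk ih => rw [single_add_row, map_mul, map_mul, ih, h q k hk]
  · exact Subsingleton.elim _ _

/-- Both sides are algebra homomorphisms, so it suffices to compare them on one-part maps, where
composition is the matrix product. -/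
theorem substHom_mul (A : Matrix T Q ℚ) (B : Matrix Q R ℚ) :
    substHom (A * B) = (substHom A).comp (substHom B) := by
  refine algHom_ext_row fun r k hk => ?_
  rw [AlgHom.comp_apply, substHom_row _ r hk, substHom_row _ r hk, map_sum,
    Finset.sum_congr rfl fun q _ => substHom_single_row A q hk (B q r), Finset.sum_comm]
  refine Finset.sum_congr rfl fun t _ => ?_
  rw [Matrix.mul_apply]
  refine (map_sum (AddMonoidAlgebra.singleAddHom (R := ℚ) (PMap.row t k : PMap T)) _ _).trans ?_
  exact Finset.sum_congr rfl fun q _ => congrArg (single _) (mul_comm _ _)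

theorem substHom_one : substHom (1 : Matrix T T ℚ) = AlgHom.id ℚ _ := by
  refine algHom_ext_row fun r k hk => ?_
  rw [substHom_row _ r hk, Finset.sum_eq_single r]
  · rw [Matrix.one_apply_eq]; rfl
  · intro t _ h
    rw [Matrix.one_apply_ne h, AddMonoidAlgebra.single_zero]
  · simp

/-- The multinomial theorem, by adding one part at a time: adjoining k at q multiplies z by k times
the new multiplicity of k in σ(q), and this multiplicity is the sum over t of those in ν(t, q). -/
theorem coeff_splitHom (A : Matrix T Q ℚ) (σ : PMap Q) (ν : PMap (T × Q)) :
    (splitHom A (single σ 1)).coeff ν =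
      if PMap.colSums ν = σ then σ.z * PMap.weight A ν else 0 := by
  induction σ using PMap.induction_row generalizing ν with
  | h0 =>
    have h1 : splitHom A (single (0 : PMap Q) 1) = single 0 1 := map_one _
    rw [h1, AddMonoidAlgebra.coeff_single, Finsupp.single_apply]
    have h2 : PMap.colSums ν = 0 ↔ 0 = ν := by
      refine ⟨fun h => funext fun x => ?_, fun h => h ▸ map_zero _⟩
      have := congrFun h x.2
      rw [PMap.colSums_apply, ← Finset.add_sum_erase _ _ (Finset.mem_univ x.1)] at this
      exact (Par.eq_zero_of_add_eq_zero this).symm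
    simp only [h2]
    split_ifs with h
    · subst h
      have hz : (0 : Par).z = 1 := rfl
      simp [PMap.z, PMap.weight, hz, Par.length, Par.parts_zero]
    · rfl
  | hadd σ q k hk ih =>
    -- The share of the terms in which the new part k is placed at (t, q); it is proportional to the
    -- multiplicity of k there.
    have hterm : ∀ t, (single (PMap.row (t, q) k) (A t q) * splitHom A (single σ 1)).coeff ν =
        if PMap.colSums ν = σ + PMap.row q k then
          σ.z * PMap.weight A ν * (k * (ν (t, q)).parts.count k) else 0 := by
      intro t
      by_cases hν : ∃ ν', ν = ν' + PMap.row (t, q) k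
      · obtain ⟨ν', rfl⟩ := hν
        have hcanc : ∀ {S : Type _} (a b c : PMap S), a + c = b + c ↔ a = b := fun a b c =>
          ⟨fun h => funext fun s => Par.add_right_cancel' (congrFun h s), fun h => by rw [h]⟩
        rw [AddMonoidAlgebra.coeff_single_mul_eq_mul_coeff ν' fun m _ => by
          rw [add_comm, hcanc], ih, map_add, PMap.colSums_row]
        have : PMap.colSums ν' + PMap.row q k = σ + PMap.row q k ↔ PMap.colSums ν' = σ :=
          ⟨fun h => funext fun s => Par.add_right_cancel' (congrFun h s), fun h => by rw [h]⟩
        simp only [this]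
        split_ifs
        · rw [mul_assoc, PMap.weight_add_row A ν' t q hk]
          ring
        · rw [mul_zero]
      -- If ν(t, q) has no part k, the left side has no such term and the multiplicity on the right
      -- is zero.
      · rw [AddMonoidAlgebra.coeff_single_mul_of_forall_add_ne _ _ fun d h =>
          hν ⟨d, by rw [← h, add_comm]⟩]
        have hc : (ν (t, q)).parts.count k = 0 := by
          rw [Multiset.count_eq_zero]
          intro hmem
          obtain ⟨l, hl⟩ := Par.exists_eq_add_row hmem
          refine hν ⟨Function.update ν (t, q) l, funext fun x => ?_⟩
          by_cases h : x = (t, q)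
          · subst h
            rw [Pi.add_apply, Function.update_self, PMap.row, Pi.single_eq_same, hl]
          · rw [Pi.add_apply, Function.update_of_ne h, PMap.row, Pi.single_eq_of_ne h, add_zero]
        simp [hc]
    rw [single_add_row, map_mul, mul_comm, splitHom_row A q hk, Finset.sum_mul,
      AddMonoidAlgebra.coeff_sum, Finsupp.finsetSum_apply, Finset.sum_congr rfl fun t _ => hterm t]
    split_ifs with h
    · rw [← Finset.mul_sum, ← Finset.mul_sum, PMap.z_add_row _ _ hk, ← h, PMap.colSums_apply,
        Par.parts_sum, Multiset.count_sum']
      push_cast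
      ring
    · rw [Finset.sum_const_zero]

end

end WreathPower
end

noncomputable section

namespace WreathPower

open Equiv
open scoped DirectSum

/-! ### Wreath powers as matrices of algebra homomorphisms -/

section

variable {T Q R : Type*} [Fintype T] [Fintype Q] [Fintype R] [DecidableEq T] [DecidableEq Q]
  [DecidableEq R]

open AddMonoidAlgebra (single)

namespace PMap

/-- The product of the character values `X (l t) (σ t)`. -/
def X (l σ : PMap T) : ℚ := ∏ t, Par.X (l t) (σ t)

theorem fst_eq_of_X_ne_zero {l σ : PMap T} (h : X l σ ≠ 0) (t : T) : (l t).1 = (σ t).1 := by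
  by_contra ht
  exact h (Finset.prod_eq_zero (Finset.mem_univ t) (Par.X_eq_zero ht))

theorem size_eq_of_X_ne_zero {l σ : PMap T} (h : X l σ ≠ 0) : σ.size = l.size :=
  Finset.sum_congr rfl fun t _ => (fst_eq_of_X_ne_zero h t).symm

theorem sum_parts_sum (σ : PMap T) : σ.size = (∑ t, (σ t).parts).sum := by
  have : (∑ t, (σ t).parts).sum = ∑ t, (σ t).parts.sum := map_sum Multiset.sumAddMonoidHom _ _
  rw [this]
  exact Finset.sum_congr rfl fun t _ => (σ t).sum_parts.symm

theorem size_rowSums (ν : PMap (T × Q)) : size (rowSums ν) = size (colSums ν) := by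
  rw [sum_parts_sum, sum_parts_sum]
  simp only [rowSums_apply, colSums_apply, Par.parts_sum]
  rw [Finset.sum_comm]

theorem finsum_eq_sum_PMapW {w : ℕ} (f : PMap T → ℚ) (hf : ∀ σ, f σ ≠ 0 → σ.size = w) :
    ∑ᶠ σ, f σ = ∑ σ : PMapW T w, f σ.1 := by
  classical
  rw [finsum_eq_sum_of_support_subset (s := Finset.univ.map (Function.Embedding.subtype fun σ : PMap T => σ.size = w)) f,
    Finset.sum_map]
  · rfl
  · intro σ hσ
    rw [Finset.mem_coe, Finset.mem_map]
    exact ⟨⟨σ, hf σ hσ⟩, Finset.mem_univ _, rfl⟩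

theorem sum_X_mul_X {w : ℕ} (l m : PMapW T w) :
    ∑ σ : PMapW T w, X l.1 σ.1 * (X m.1 σ.1 / z σ.1) = if l = m then 1 else 0 := by
  classical
  have h0 : ∀ σ, X l.1 σ * (X m.1 σ / z σ) ≠ 0 → X l.1 σ ≠ 0 := fun σ h => left_ne_zero_of_mul h
  rw [← finsum_eq_sum_PMapW (fun σ => X l.1 σ * (X m.1 σ / z σ)) fun σ hσ =>
    (size_eq_of_X_ne_zero (h0 σ hσ)).trans l.2,
    finsum_eq_sum_of_support_subset (s := Fintype.piFinset fun t => Par.ofSize (l.1 t).1)]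
  · have h1 : ∀ σ : PMap T, X l.1 σ * (X m.1 σ / z σ) =
        ∏ t, Par.X (l.1 t) (σ t) * Par.X (m.1 t) (σ t) / (σ t).z := fun σ => by
      rw [Finset.prod_div_distrib, Finset.prod_mul_distrib, mul_div_assoc]; rfl
    rw [Finset.sum_congr rfl fun σ _ => h1 σ, ← Finset.prod_univ_sum (fun t => Par.ofSize (l.1 t).1)
      fun t k => Par.X (l.1 t) k * Par.X (m.1 t) k / k.z,
      Finset.prod_congr rfl fun t _ => Par.sum_X_mul_X (l.1 t) (m.1 t)]
    split_ifs with h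
    · subst h
      exact Finset.prod_eq_one fun t _ => if_pos rfl
    · have : ∃ t, l.1 t ≠ m.1 t := by
        by_contra! h'
        exact h (Subtype.ext (funext h'))
      obtain ⟨t, ht⟩ := this
      exact Finset.prod_eq_zero (Finset.mem_univ t) (if_neg ht)
  · intro σ hσ
    rw [Finset.mem_coe, Fintype.mem_piFinset]
    exact fun t => Par.mem_ofSize.2 (fst_eq_of_X_ne_zero (h0 σ hσ) t).symm

/-- The character table in degree w is square, so the right inverse provided by row orthogonality is
also a left inverse. -/
theorem sum_X_mul_X' {w : ℕ} (σ τ : PMapW T w) :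
    ∑ l : PMapW T w, X l.1 σ.1 / z σ.1 * X l.1 τ.1 = if σ = τ then 1 else 0 := by
  have h : Matrix.of (fun l σ : PMapW T w => X l.1 σ.1) *
      Matrix.of (fun σ m : PMapW T w => X m.1 σ.1 / z σ.1) = 1 := by
    ext l m
    simp only [Matrix.mul_apply, Matrix.of_apply, sum_X_mul_X, Matrix.one_apply]
  rw [mul_eq_one_comm] at h
  have h' := congrFun (congrFun h σ) τ
  simpa only [Matrix.mul_apply, Matrix.of_apply, Matrix.one_apply] using h'

end PMap

theorem wreath_s_apply' (A : Matrix T Q ℚ) (l : PMap T) (m : PMap Q) :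
    wreath A Par.s Par.s l m = ∑ᶠ ν : PMap (T × Q),
      PMap.X l (PMap.rowSums ν) * PMap.X m (PMap.colSums ν) * PMap.weight A ν := by
  rw [wreath_s_apply]
  refine finsum_congr fun ν => ?_
  rw [PMap.weight, Fintype.prod_prod_type]
  rfl

/-- The linear functional on formal combinations of partition-valued maps given by the character
values `X l`. -/
def charFun (l : PMap T) : PAlg T →ₗ[ℚ] ℚ :=
  Finsupp.linearCombination ℚ (PMap.X l) ∘ₗ (AddMonoidAlgebra.coeffLinearEquiv ℚ).toLinearMap

theorem charFun_apply (l : PMap T) (x : PAlg T) :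
    charFun l x = Finsupp.linearCombination ℚ (PMap.X l) x.coeff := rfl

theorem charFun_single (l σ : PMap T) (c : ℚ) : charFun l (single σ c) = c * PMap.X l σ := by
  rw [charFun_apply, AddMonoidAlgebra.coeff_single, Finsupp.linearCombination_single, smul_eq_mul]

/-- The expansion of a product of Schur functions in power sums. -/
def schur {w : ℕ} (m : PMapW T w) : PAlg T :=
  ∑ σ : PMapW T w, single σ.1 (PMap.X m.1 σ.1 / PMap.z σ.1)

theorem charFun_schur {w : ℕ} (l m : PMapW T w) :
    charFun l.1 (schur m) = if l = m then 1 else 0 := by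
  rw [schur, map_sum, ← PMap.sum_X_mul_X]
  exact Finset.sum_congr rfl fun σ _ => by rw [charFun_single, mul_comm]

theorem sum_smul_schur {w : ℕ} (τ : PMapW T w) :
    ∑ m : PMapW T w, PMap.X m.1 τ.1 • schur m = single τ.1 1 := by
  simp only [schur, Finset.smul_sum, AddMonoidAlgebra.smul_single, smul_eq_mul]
  rw [Finset.sum_comm]
  have h : ∀ σ : PMapW T w, ∑ m : PMapW T w,
      (single σ.1 (PMap.X m.1 τ.1 * (PMap.X m.1 σ.1 / PMap.z σ.1)) : PAlg T) =
        single σ.1 (if σ = τ then 1 else 0) := by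
    intro σ
    rw [← PMap.sum_X_mul_X']
    refine ((map_sum (AddMonoidAlgebra.singleAddHom (R := ℚ) σ.1) _ _).trans ?_).symm
    exact Finset.sum_congr rfl fun m _ => congrArg (single _) (mul_comm _ _)
  rw [Finset.sum_congr rfl fun σ _ => h σ, Finset.sum_eq_single τ, if_pos rfl]
  · intro σ _ hσ
    rw [if_neg hσ, AddMonoidAlgebra.single_zero]
  · simp

/-- The homogeneous component of degree `w`. -/
def homog (T : Type*) [Fintype T] (w : ℕ) : Submodule ℚ (PAlg T) :=
  Submodule.span ℚ {x | ∃ σ : PMap T, σ.size = w ∧ x = single σ 1}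

theorem single_mem_homog {w : ℕ} {σ : PMap T} (hσ : σ.size = w) (c : ℚ) :
    single σ c ∈ homog T w := by
  have : (single σ c : PAlg T) = c • single σ 1 := by
    rw [AddMonoidAlgebra.smul_single, smul_eq_mul, mul_one]
  rw [this]
  exact Submodule.smul_mem _ _ (Submodule.subset_span ⟨σ, hσ, rfl⟩)

/-- The functionals `charFun` are the coordinates for the basis `schur` of the degree w component.
-/
theorem sum_charFun_smul_schur {w : ℕ} {x : PAlg T} (hx : x ∈ homog T w) :
    ∑ m : PMapW T w, charFun m.1 x • schur m = x := by
  induction hx using Submodule.span_induction with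
  | mem x hx =>
    obtain ⟨σ, hσ, rfl⟩ := hx
    simp only [charFun_single, one_mul]
    exact sum_smul_schur ⟨σ, hσ⟩
  | zero => simp
  | add x y _ _ hx hy =>
    simp only [map_add, add_smul, Finset.sum_add_distrib, hx, hy]
  | smul c x _ hx =>
    simp only [map_smul, smul_assoc, ← Finset.smul_sum, hx]

theorem substHom_single_eq_sum (A : Matrix T Q ℚ) (σ : PMap Q) : substHom A (single σ 1) =
    (splitHom A (single σ 1)).coeff.sum fun ν c => single (PMap.rowSums ν) c := by
  rw [substHom_apply]
  conv_lhs => rw [← AddMonoidAlgebra.sum_coeff_single (splitHom A (single σ 1))]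
  exact (AddMonoidAlgebra.mapDomain_sum _ _ _).trans
    (Finset.sum_congr rfl fun _ _ => AddMonoidAlgebra.mapDomain_single)

theorem substHom_mem_homog (A : Matrix T Q ℚ) {w : ℕ} {x : PAlg Q} (hx : x ∈ homog Q w) :
    substHom A x ∈ homog T w := by
  induction hx using Submodule.span_induction with
  | mem x hx =>
    obtain ⟨σ, hσ, rfl⟩ := hx
    rw [substHom_single_eq_sum]
    refine Submodule.sum_mem _ fun ν hν => single_mem_homog ?_ _
    rw [Finsupp.mem_support_iff, coeff_splitHom] at hν
    rw [PMap.size_rowSums, ← hσ]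
    by_contra h
    exact hν (if_neg fun e => h (by rw [e]))
  | zero => rw [map_zero]; exact Submodule.zero_mem _
  | add x y _ _ hx hy => rw [map_add]; exact Submodule.add_mem _ hx hy
  | smul c x _ hx => rw [map_smul]; exact Submodule.smul_mem _ _ hx

theorem charFun_substHom_single (A : Matrix T Q ℚ) (l : PMap T) (σ : PMap Q) :
    charFun l (substHom A (single σ 1)) = ∑ᶠ ν : PMap (T × Q),
      (if PMap.colSums ν = σ then σ.z * PMap.weight A ν else 0) * PMap.X l (PMap.rowSums ν) := by
  rw [substHom_single_eq_sum, Finsupp.sum, map_sum, finsum_eq_sum_of_support_subset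
    (s := (splitHom A (single σ 1)).coeff.support)]
  · exact Finset.sum_congr rfl fun ν _ => by rw [charFun_single, coeff_splitHom]
  · intro ν hν
    rw [Finset.mem_coe, Finsupp.mem_support_iff, coeff_splitHom]
    exact left_ne_zero_of_mul hν

/-- Allows the finite sum over σ to be exchanged with the sum over ν. -/
theorem finite_support_colSums (A : Matrix T Q ℚ) (σ : PMap Q) (f : PMap (T × Q) → ℚ) :
    Function.HasFiniteSupport fun ν : PMap (T × Q) =>
      (if PMap.colSums ν = σ then σ.z * PMap.weight A ν else 0) * f ν := by
  refine (splitHom A (single σ 1)).coeff.support.finite_toSet.subset fun ν hν => ?_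
  rw [Finset.mem_coe, Finsupp.mem_support_iff, coeff_splitHom]
  exact left_ne_zero_of_mul hν

/-- Identifies the wreath power with the matrix of `substHom A` in the Schur bases; multiplicativity
is then formal. -/
theorem wreathPow_s_apply (A : Matrix T Q ℚ) {w : ℕ} (l : PMapW T w) (m : PMapW Q w) :
    wreathPow A w Par.s Par.s l m = charFun l.1 (substHom A (schur m)) := by
  classical
  have h1 : ∀ σ : PMapW Q w,
      charFun l.1 (substHom A (single σ.1 (PMap.X m.1 σ.1 / PMap.z σ.1))) =
      ∑ᶠ ν : PMap (T × Q), (if PMap.colSums ν = σ.1 then σ.1.z * PMap.weight A ν else 0) *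
        (PMap.X l.1 (PMap.rowSums ν) * (PMap.X m.1 σ.1 / PMap.z σ.1)) := by
    intro σ
    have : (single σ.1 (PMap.X m.1 σ.1 / PMap.z σ.1) : PAlg Q) =
        (PMap.X m.1 σ.1 / PMap.z σ.1) • single σ.1 1 := by
      rw [AddMonoidAlgebra.smul_single, smul_eq_mul, mul_one]
    rw [this, map_smul, map_smul, charFun_substHom_single, smul_eq_mul, mul_comm, finsum_mul]
    exact finsum_congr fun ν => by rw [mul_assoc]
  rw [schur, map_sum, map_sum, Finset.sum_congr rfl fun σ _ => h1 σ,
    ← finsum_sum_comm _ _ fun σ _ => finite_support_colSums A σ.1 _]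
  refine (wreath_s_apply' A l.1 m.1).trans (finsum_congr fun ν => ?_)
  -- For fixed ν only σ = `colSums ν` survives, and its z cancels the one in `schur`. If `colSums ν`
  -- has the wrong size, the character value X m vanishes.
  by_cases h : PMap.size (PMap.colSums ν) = w
  · rw [Finset.sum_eq_single ⟨_, h⟩]
    · have := PMap.z_ne_zero (PMap.colSums ν)
      rw [if_pos rfl]
      field_simp
    · intro σ _ hσ
      rw [if_neg fun e => hσ (Subtype.ext e.symm), zero_mul]
    · simp
  · have hX : PMap.X m.1 (PMap.colSums ν) = 0 := by
      by_contra h'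
      exact h ((PMap.size_eq_of_X_ne_zero h').trans m.2)
    rw [hX, mul_zero, zero_mul, Finset.sum_eq_zero]
    intro σ _
    rw [if_neg fun e => h (by rw [e, σ.2]), zero_mul]

theorem wreathPow_one (w : ℕ) : wreathPow (1 : Matrix T T ℚ) w Par.s Par.s = 1 := by
  classical
  ext l m
  rw [wreathPow_s_apply, substHom_one, AlgHom.id_apply, charFun_schur, Matrix.one_apply]

/-- The element `substHom B (schur n)` is again of degree w, so it can be expanded in the Schur
basis before `substHom A` is applied. -/
theorem wreathPow_mul (A : Matrix T Q ℚ) (B : Matrix Q R ℚ) (w : ℕ) :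
    wreathPow (A * B) w Par.s Par.s =
      wreathPow A w Par.s Par.s * wreathPow B w Par.s Par.s := by
  ext l n
  have hn : substHom B (schur n) ∈ homog Q w := substHom_mem_homog B
    (Submodule.sum_mem _ fun σ _ => single_mem_homog σ.2 _)
  rw [Matrix.mul_apply, wreathPow_s_apply, substHom_mul, AlgHom.comp_apply]
  conv_lhs => rw [← sum_charFun_smul_schur hn, map_sum, map_sum]
  refine Finset.sum_congr rfl fun m _ => ?_
  rw [map_smul, map_smul, wreathPow_s_apply, wreathPow_s_apply, smul_eq_mul, mul_comm]

end

end WreathPower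
end

noncomputable section

namespace WreathPower

open Equiv
open scoped DirectSum

/-! ### Virtual characters -/

/-- The characters of the finite-dimensional rational representations of `G`. -/
def characters (G : Type*) [Group G] : Submonoid (G → ℚ) where
  carrier := {f | ∃ (V : Type) (_ : AddCommGroup V) (_ : Module ℚ V) (_ : FiniteDimensional ℚ V)
    (ρ : Representation ℚ G V), ρ.character = f}
  one_mem' := ⟨ℚ, inferInstance, inferInstance, inferInstance, 1, by
    funext g
    simp [Representation.character]⟩
  mul_mem' := by
    rintro _ _ ⟨V, _, _, _, ρ, rfl⟩ ⟨W, _, _, _, σ, rfl⟩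
    exact ⟨TensorProduct ℚ V W, inferInstance, inferInstance, inferInstance, ρ.tprod σ,
      Representation.char_tensor ρ σ⟩

/-- The ring of differences of characters of finite-dimensional rational representations. -/
def virtualCharacters (G : Type*) [Group G] : Subring (G → ℚ) :=
  Subring.closure (characters G)

section

variable {G H : Type*} [Group G] [Group H]

theorem character_mem {V : Type} [AddCommGroup V] [Module ℚ V] [FiniteDimensional ℚ V]
    (ρ : Representation ℚ G V) : ρ.character ∈ virtualCharacters G :=
  Subring.subset_closure ⟨V, inferInstance, inferInstance, inferInstance, ρ, rfl⟩

theorem comp_mem_virtualCharacters (φ : H →* G) {f : G → ℚ} (hf : f ∈ virtualCharacters G) :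
    (fun h => f (φ h)) ∈ virtualCharacters H := by
  let Φ : (G → ℚ) →+* (H → ℚ) := RingHom.pi fun h => Pi.evalRingHom _ (φ h)
  have hle : virtualCharacters G ≤ (virtualCharacters H).comap Φ := by
    rw [virtualCharacters, Subring.closure_le]
    rintro _ ⟨V, _, _, _, ρ, rfl⟩
    exact character_mem (MonoidHom.comp ρ φ : Representation ℚ H V)
  exact hle hf

/-- The average of a character is the dimension of the invariants. -/
theorem exists_int_average [Fintype G] {f : G → ℚ} (hf : f ∈ virtualCharacters G) :
    ∃ k : ℤ, (Fintype.card G : ℚ)⁻¹ * ∑ g, f g = k := by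
  -- Characters are closed under products, so the ring they generate is already their additive
  -- closure.
  rw [virtualCharacters, Subring.mem_closure_iff, Submonoid.closure_eq] at hf
  induction hf using AddSubgroup.closure_induction with
  | mem f hf =>
    obtain ⟨V, _, _, _, ρ, rfl⟩ := hf
    have : Invertible (Nat.card G : ℚ) := invertibleOfNonzero (Nat.cast_ne_zero.2 Nat.card_pos.ne')
    have h := Representation.card_inv_mul_sum_char_eq_finrank ρ
    rw [Nat.card_eq_fintype_card] at h
    exact ⟨Module.finrank ℚ ρ.invariants, by rw [h, Int.cast_natCast]⟩
  | zero => exact ⟨0, by simp⟩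
  | add f f' _ _ hf hf' =>
    obtain ⟨k, hk⟩ := hf
    obtain ⟨k', hk'⟩ := hf'
    exact ⟨k + k', by simp only [Pi.add_apply, Finset.sum_add_distrib, mul_add, hk, hk',
      Int.cast_add]⟩
  | neg f _ hf =>
    obtain ⟨k, hk⟩ := hf
    exact ⟨-k, by simp only [Pi.neg_apply, Finset.sum_neg_distrib, mul_neg, hk, Int.cast_neg]⟩

theorem sCF_mem (l : Par) : l.sCF.1 ∈ virtualCharacters (Perm (Fin l.1)) :=
  character_mem l.spechtRep

theorem card_fixedPoints_mem {Y : Type} [Fintype Y] [DecidableEq Y] :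
    (fun σ : Perm Y => ((Finset.univ.filter fun y => σ y = y).card : ℚ)) ∈
      virtualCharacters (Perm Y) := by
  let ρ : Representation ℚ (Perm Y) (Y → ℚ) :=
    { toFun := fun σ => LinearMap.funLeft ℚ ℚ (⇑σ⁻¹ : Y → Y)
      map_one' := rfl
      map_mul' := fun σ τ => by rw [mul_inv_rev]; rfl }
  convert character_mem ρ using 1
  funext σ
  rw [Representation.character, LinearMap.trace_eq_matrix_trace ℚ (Pi.basisFun ℚ Y),
    LinearMap.toMatrix_eq_toMatrix', Matrix.trace, ← Finset.sum_boole]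
  refine Finset.sum_congr rfl fun y _ => ?_
  rw [Matrix.diag_apply, LinearMap.toMatrix'_apply]
  change _ = (Pi.single y 1 : Y → ℚ) (σ⁻¹ y)
  rw [Pi.single_apply]
  refine if_congr ?_ rfl rfl
  rw [Perm.inv_eq_iff_eq, eq_comm]

theorem sign_mem {n : ℕ} :
    (fun g : Perm (Fin n) => ((Perm.sign g : ℤ) : ℚ)) ∈ virtualCharacters (Perm (Fin n)) := by
  let ρ : Representation ℚ (Perm (Fin n)) ℚ :=
    { toFun := fun g => ((Perm.sign g : ℤ) : ℚ) • LinearMap.id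
      map_one' := by simp; rfl
      map_mul' := fun g h => by
        ext
        simp [mul_comm] }
  convert character_mem ρ using 1
  funext g
  change _ = LinearMap.trace ℚ ℚ (((Perm.sign g : ℤ) : ℚ) • LinearMap.id)
  simp

end

/-! ### The number of cycles -/

section

variable {α : Type*} [Fintype α] [DecidableEq α]

theorem card_quotient_sameCycle (g : Perm α) :
    Nat.card (Quotient (Perm.SameCycle.setoid g)) = g.partition.parts.card := by
  classical
  -- An orbit is encoded by its nontrivial cycle or by its fixed point.
  let F : α → Perm α ⊕ α := fun x => if g x = x then Sum.inr x else Sum.inl (g.cycleOf x)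
  have hF : ∀ x y, F x = F y ↔ g.SameCycle x y := by
    intro x y
    by_cases hx : g x = x <;> by_cases hy : g y = y
    · simp only [F, if_pos hx, if_pos hy, Sum.inr.injEq]
      exact ⟨fun h => h ▸ Perm.SameCycle.rfl, fun h => h.eq_of_left hx⟩
    · simp only [F, if_pos hx, if_neg hy, reduceCtorEq, false_iff]
      exact fun h => hy (h.apply_eq_self_iff.1 hx)
    · simp only [F, if_neg hx, if_pos hy, reduceCtorEq, false_iff]
      exact fun h => hx (h.apply_eq_self_iff.2 hy)
    · simp only [F, if_neg hx, if_neg hy, Sum.inl.injEq]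
      exact (Perm.sameCycle_iff_cycleOf_eq_of_mem_support (Perm.mem_support.2 hx)
        (Perm.mem_support.2 hy)).symm
  let F' : Quotient (Perm.SameCycle.setoid g) → Perm α ⊕ α := Quotient.lift F fun x y h => (hF x y).2 h
  have hinj : Function.Injective F' := by
    intro a b
    induction a using Quotient.inductionOn
    induction b using Quotient.inductionOn
    exact fun h => Quotient.sound ((hF _ _).1 h)
  have himage : Finset.univ.image F' =
      g.cycleFactorsFinset.disjSum (Finset.univ.filter fun x => g x = x) := by
    ext y
    simp only [Finset.mem_image, Finset.mem_univ, true_and]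
    constructor
    · rintro ⟨a, rfl⟩
      induction a using Quotient.inductionOn with
      | h x =>
        change F x ∈ _
        by_cases hx : g x = x
        · simp only [F, if_pos hx, Finset.inr_mem_disjSum, Finset.mem_filter, Finset.mem_univ, hx,
            and_self]
        · simp only [F, if_neg hx, Finset.inl_mem_disjSum]
          exact Perm.cycleOf_mem_cycleFactorsFinset_iff.2 (Perm.mem_support.2 hx)
    · intro hy
      rcases y with c | x
      · rw [Finset.inl_mem_disjSum] at hy
        obtain ⟨x, hx⟩ := (Perm.mem_cycleFactorsFinset_iff.1 hy).1.nonempty_support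
        refine ⟨Quotient.mk _ x, ?_⟩
        change F x = _
        have hx' := Perm.mem_support.1 (Perm.mem_cycleFactorsFinset_support_le hy hx)
        simp only [F, if_neg hx']
        rw [← Perm.cycle_is_cycleOf hx hy]
      · rw [Finset.inr_mem_disjSum, Finset.mem_filter] at hy
        exact ⟨Quotient.mk _ x, if_pos hy.2⟩
  rw [Nat.card_eq_fintype_card, ← Finset.card_univ, ← Finset.card_image_of_injective _ hinj, himage,
    Finset.card_disjSum, Perm.parts_partition, Multiset.card_add, Multiset.card_replicate,
    Perm.cycleType_def, Multiset.card_map]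
  congr 1
  have h1 := Finset.card_filter_add_card_filter_not (s := (Finset.univ : Finset α)) (fun x => g x = x)
  have h2 : (Finset.univ.filter fun x => ¬ g x = x) = g.support := by
    ext x; simp
  rw [h2, Finset.card_univ] at h1
  omega

theorem card_invariant_functions {β : Type*} [Fintype β] (g : Perm α)
    [DecidablePred fun f : α → β => ∀ x, f (g x) = f x] :
    (Finset.univ.filter fun f : α → β => ∀ x, f (g x) = f x).card =
      Fintype.card β ^ g.partition.parts.card := by
  classical
  have hconst : ∀ f : α → β, (∀ x, f (g x) = f x) → ∀ x y, g.SameCycle x y → f x = f y := by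
    rintro f hf x _ ⟨i, rfl⟩
    let S : Subgroup (Perm α) :=
      { carrier := {h | ∀ x, f (h x) = f x}
        one_mem' := fun _ => rfl
        mul_mem' := fun {a b} ha hb x => (ha (b x)).trans (hb x)
        inv_mem' := fun {a} ha x => by
          have := ha (a⁻¹ x)
          rw [← Perm.mul_apply, mul_inv_cancel, Perm.one_apply] at this
          exact this.symm }
    exact (S.zpow_mem (show g ∈ S from hf) i x).symm
  rw [← card_quotient_sameCycle, Nat.card_eq_fintype_card, ← Fintype.card_fun, ← Finset.card_univ]
  refine (Finset.card_bij (fun (u : Quotient (Perm.SameCycle.setoid g) → β) _ x =>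
    u (Quotient.mk _ x)) (fun u _ => ?_) (fun u _ v _ h => ?_) fun f hf => ?_).symm
  · refine Finset.mem_filter.2 ⟨Finset.mem_univ _, fun x => congrArg u (Quotient.sound ?_)⟩
    exact Perm.sameCycle_apply_left.2 Perm.SameCycle.rfl
  · funext a
    induction a using Quotient.inductionOn with
    | h x => exact congrFun h x
  · exact ⟨Quotient.lift f (hconst f (Finset.mem_filter.1 hf).2), Finset.mem_univ _, rfl⟩

end

/-- This is the permutation character on words of length n in a letters: a word is fixed exactly
when it is constant on cycles. -/
theorem natCast_pow_length_mem (a n : ℕ) : (fun g : Perm (Fin n) => (a : ℚ) ^ (Par.cyc g).length) ∈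
    virtualCharacters (Perm (Fin n)) := by
  let φ : Perm (Fin n) →* Perm (Fin n → Fin a) :=
    { toFun := fun g => ⟨fun f x => f (g⁻¹ x), fun f x => f (g x), fun f => by simp, fun f => by simp⟩
      map_one' := rfl
      map_mul' := fun g h => by
        ext f x
        simp [mul_inv_rev] }
  convert comp_mem_virtualCharacters φ card_fixedPoints_mem using 1
  funext g
  have h := card_invariant_functions (β := Fin a) g
  rw [Fintype.card_fin] at h
  rw [Par.length, Par.parts_cyc, ← Nat.cast_pow, ← h]
  refine congrArg (fun s : Finset (Fin n → Fin a) => (s.card : ℚ)) (Finset.filter_congr fun f _ => ?_)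
  rw [funext_iff]
  change _ ↔ ∀ x, f (g⁻¹ x) = f x
  refine ⟨fun hf x => ?_, fun hf x => ?_⟩
  · rw [← hf (g⁻¹ x)]; simp
  · rw [← hf (g x)]; simp

theorem neg_one_pow_length {n : ℕ} (g : Perm (Fin n)) :
    (-1 : ℚ) ^ (Par.cyc g).length = (-1) ^ n * ((Perm.sign g : ℤ) : ℚ) := by
  have h1 := g.sum_cycleType_le
  rw [Fintype.card_fin] at h1
  rw [Par.length, Par.parts_cyc, parts_partition_eq, Perm.sign_of_cycleType, Multiset.card_add,
    Multiset.card_replicate, Fintype.card_fin]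
  push_cast
  rw [← pow_add]
  -- The sign has exponent `sum + card` of the cycle type; adding n gives the number of cycles up to
  -- an even number.
  have : n + (g.cycleType.sum + g.cycleType.card) =
      (g.cycleType.card + (n - g.cycleType.sum)) + 2 * g.cycleType.sum := by omega
  rw [this, pow_add _ _ (2 * _), pow_mul]
  simp

theorem intCast_pow_length_mem (a : ℤ) (n : ℕ) :
    (fun g : Perm (Fin n) => (a : ℚ) ^ (Par.cyc g).length) ∈ virtualCharacters (Perm (Fin n)) := by
  obtain ⟨b, rfl | rfl⟩ := a.eq_nat_or_neg
  · exact_mod_cast natCast_pow_length_mem b n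
  · have h : (fun g : Perm (Fin n) => ((-(b : ℤ) : ℤ) : ℚ) ^ (Par.cyc g).length) =
        (-1) ^ n * (fun g : Perm (Fin n) => ((Perm.sign g : ℤ) : ℚ)) *
          fun g => (b : ℚ) ^ (Par.cyc g).length := by
      funext g
      simp only [Pi.mul_apply, Pi.pow_apply, Pi.neg_apply, Pi.one_apply]
      rw [← neg_one_pow_length, ← mul_pow]
      push_cast
      rw [neg_one_mul]
    rw [h]
    exact mul_mem (mul_mem (pow_mem (neg_mem (one_mem _)) _) sign_mem) (natCast_pow_length_mem b n)

/-! ### Integrality of wreath powers -/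

theorem Par.fst_sum {ι : Type*} (s : Finset ι) (f : ι → Par) : (∑ i ∈ s, f i).1 = ∑ i ∈ s, (f i).1 := by
  let φ : Par →+ ℕ := { toFun := Sigma.fst, map_zero' := rfl, map_add' := fun _ _ => rfl }
  exact map_sum φ f s

/-- The sum of cycle types is the type of the block permutation, so this is a Specht character
pulled back to a product of symmetric groups, or zero if the sizes differ. The map j lets it serve
rows and columns of T × Q alike. -/
theorem X_sum_cyc_mem {ι κ : Type*} [Fintype ι] {n : κ → ℕ} (j : ι → κ) (l : Par) :
    (fun g : ∀ k, Perm (Fin (n k)) => Par.X l (∑ i, Par.cyc (g (j i)))) ∈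
      virtualCharacters (∀ k, Perm (Fin (n k))) := by
  have hs : ∀ g : ∀ k, Perm (Fin (n k)), (∑ i, Par.cyc (g (j i))).1 = ∑ i, n (j i) := fun g => by
    rw [Par.fst_sum]
    exact Finset.sum_congr rfl fun i _ => Par.fst_cyc _
  by_cases h : l.1 = ∑ i, n (j i)
  -- Any bijection serves, as only the cycle type matters.
  · let e : (Σ i, Fin (n (j i))) ≃ Fin l.1 := Fintype.equivFinOfCardEq (by simp [h])
    let φ : (∀ k, Perm (Fin (n k))) →* ∀ i, Perm (Fin (n (j i))) :=
      MonoidHom.pi fun i => Pi.evalMonoidHom (fun k => Perm (Fin (n k))) (j i)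
    convert comp_mem_virtualCharacters ((youngPiHom e).comp φ) (sCF_mem l) using 1
    funext g
    refine Par.X_eq_sCF _ _ _ ?_
    rw [MonoidHom.comp_apply, parts_partition_youngPiHom, Par.parts_sum]
    rfl
  · have : (fun g : ∀ k, Perm (Fin (n k)) => Par.X l (∑ i, Par.cyc (g (j i)))) = 0 :=
      funext fun g => Par.X_eq_zero (by rw [hs]; exact h)
    rw [this]
    exact zero_mem _

section

variable {T Q : Type*} [Fintype T] [Fintype Q] [DecidableEq T] [DecidableEq Q]

theorem prod_mem_virtualCharacters {G ι : Type*} [Group G] (s : Finset ι) (f : ι → G → ℚ)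
    (hf : ∀ i ∈ s, f i ∈ virtualCharacters G) :
    (fun g => ∏ i ∈ s, f i g) ∈ virtualCharacters G := by
  have h := Subring.prod_mem _ hf
  rwa [Finset.prod_fn] at h

/-- With the sizes n(t, q) fixed, the weights 1/z_ν turn the sum over ν into an average over ∏
S_{n(t,q)} of a virtual character. -/
theorem exists_int_wreathPow (A : Matrix T Q ℤ) {w : ℕ} (l : PMapW T w) (m : PMapW Q w) :
    ∃ k : ℤ, wreathPow (A.map (Int.cast : ℤ → ℚ)) w Par.s Par.s l m = k := by
  classical
  let F : PMap (T × Q) → ℚ := fun ν =>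
    PMap.X l.1 (PMap.rowSums ν) * PMap.X m.1 (PMap.colSums ν) *
      ∏ x : T × Q, (A x.1 x.2 : ℚ) ^ (ν x).length
  -- A finite set containing the support, since nonzero terms have all sizes at most w.
  let box : Finset (PMap (T × Q)) :=
    Fintype.piFinset fun _ => (Finset.range (w + 1)).biUnion Par.ofSize
  have h1 : wreathPow (A.map (Int.cast : ℤ → ℚ)) w Par.s Par.s l m =
      ∑ ν ∈ box, F ν / PMap.z ν := by
    refine (wreath_s_apply' _ l.1 m.1).trans ?_
    rw [finsum_eq_sum_of_support_subset (s := box)]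
    · refine Finset.sum_congr rfl fun ν _ => ?_
      rw [PMap.weight, Finset.prod_div_distrib, ← mul_div_assoc]
      rfl
    · intro ν hν
      have hX : PMap.X l.1 (PMap.rowSums ν) ≠ 0 :=
        left_ne_zero_of_mul (left_ne_zero_of_mul hν)
      rw [Finset.mem_coe, Fintype.mem_piFinset]
      rintro ⟨t, q⟩
      refine Finset.mem_biUnion.2 ⟨(ν (t, q)).1, Finset.mem_range.2 (Nat.lt_succ_of_le ?_),
        Par.mem_ofSize.2 rfl⟩
      have h2 := PMap.fst_eq_of_X_ne_zero hX t
      rw [PMap.rowSums_apply, Par.fst_sum] at h2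
      calc (ν (t, q)).1 ≤ ∑ q, (ν (t, q)).1 :=
            Finset.single_le_sum (f := fun q => (ν (t, q)).1) (fun _ _ => Nat.zero_le _)
              (Finset.mem_univ q)
        _ = (l.1 t).size := h2.symm
        _ ≤ l.1.size := Finset.single_le_sum (f := fun t => (l.1 t).size)
              (fun _ _ => Nat.zero_le _) (Finset.mem_univ t)
        _ = w := l.2
  -- Group the ν by the array n of their sizes, one product of symmetric groups for each array.
  have h2 : ∑ ν ∈ box, F ν / PMap.z ν = ∑ n ∈ Fintype.piFinset fun _ : T × Q => Finset.range (w + 1),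
      ∑ ν ∈ Fintype.piFinset fun x => Par.ofSize (n x), F ν / PMap.z ν := by
    rw [← Finset.sum_fiberwise_of_maps_to (g := fun (ν : PMap (T × Q)) x => (ν x).1)
      (t := Fintype.piFinset fun _ : T × Q => Finset.range (w + 1))]
    · refine Finset.sum_congr rfl fun n hn => Finset.sum_congr ?_ fun _ _ => rfl
      ext ν
      simp only [box, Finset.mem_filter, Fintype.mem_piFinset, Finset.mem_biUnion, Par.mem_ofSize,
        funext_iff]
      exact ⟨fun h => h.2, fun h => ⟨fun x => ⟨n x, Fintype.mem_piFinset.1 hn x, h x⟩, h⟩⟩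
    · intro ν hν
      refine Fintype.mem_piFinset.2 fun x => ?_
      obtain ⟨k, hk, hk'⟩ := Finset.mem_biUnion.1 (Fintype.mem_piFinset.1 hν x)
      rw [Par.mem_ofSize.1 hk']
      exact hk
  have h3 : ∀ n : T × Q → ℕ,
      ∃ k : ℤ, ∑ ν ∈ Fintype.piFinset fun x => Par.ofSize (n x), F ν / PMap.z ν = k := by
    intro n
    have hmem : (fun g : ∀ x, Perm (Fin (n x)) => F fun x => Par.cyc (g x)) ∈
        virtualCharacters (∀ x, Perm (Fin (n x))) := by
      refine mul_mem (mul_mem ?_ ?_) ?_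
      · exact prod_mem_virtualCharacters _ _ fun t _ => X_sum_cyc_mem (fun q => (t, q)) (l.1 t)
      · exact prod_mem_virtualCharacters _ _ fun q _ => X_sum_cyc_mem (fun t => (t, q)) (m.1 q)
      · exact prod_mem_virtualCharacters _ _ fun x _ => comp_mem_virtualCharacters
          (Pi.evalMonoidHom (fun x => Perm (Fin (n x))) x) (intCast_pow_length_mem (A x.1 x.2) (n x))
    obtain ⟨k, hk⟩ := exists_int_average hmem
    refine ⟨k, ?_⟩
    have hcard : (Fintype.card (∀ x, Perm (Fin (n x))) : ℚ) = ∏ x, ((n x).factorial : ℚ) := by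
      rw [Fintype.card_pi, Nat.cast_prod]
      exact Finset.prod_congr rfl fun x _ => by rw [Fintype.card_perm, Fintype.card_fin]
    have hne : ∏ x, ((n x).factorial : ℚ) ≠ 0 :=
      Finset.prod_ne_zero_iff.2 fun x _ => Nat.cast_ne_zero.2 (Nat.factorial_ne_zero _)
    rw [← hk, Par.sum_cyc, hcard, ← mul_assoc, inv_mul_cancel₀ hne, one_mul]
    rfl
  choose k hk using h3
  refine ⟨∑ n ∈ Fintype.piFinset fun _ : T × Q => Finset.range (w + 1), k n, ?_⟩
  rw [h1, h2, Int.cast_sum]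
  exact Finset.sum_congr rfl fun n _ => hk n

/-- The wreath power of an invertible integral matrix is an invertible integral matrix. -/
theorem exists_GL_wreathPow (U : Matrix.GeneralLinearGroup T ℤ) (w : ℕ) :
    ∃ V : Matrix.GeneralLinearGroup (PMapW T w) ℤ,
      (V : Matrix (PMapW T w) (PMapW T w) ℤ).map (algebraMap ℤ ℚ) =
        wreathPow ((U : Matrix T T ℤ).map (algebraMap ℤ ℚ)) w Par.s Par.s := by
  have hex : ∀ M : Matrix T T ℤ, ∃ N : Matrix (PMapW T w) (PMapW T w) ℤ,
      N.map (algebraMap ℤ ℚ) = wreathPow (M.map (algebraMap ℤ ℚ)) w Par.s Par.s := by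
    intro M
    choose N hN using fun l m => exists_int_wreathPow M (w := w) l m
    exact ⟨N, by ext l m; exact (hN l m).symm⟩
  have hinj : Function.Injective fun N : Matrix (PMapW T w) (PMapW T w) ℤ =>
      N.map (algebraMap ℤ ℚ) := Matrix.map_injective Int.cast_injective
  -- Inverse pairs go to inverse pairs by functoriality over ℚ, and the identity descends to ℤ
  -- because ℤ embeds in ℚ.
  have hmul : ∀ M M' : Matrix T T ℤ, M * M' = 1 → ∀ N N' : Matrix (PMapW T w) (PMapW T w) ℤ,
      N.map (algebraMap ℤ ℚ) = wreathPow (M.map (algebraMap ℤ ℚ)) w Par.s Par.s →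
      N'.map (algebraMap ℤ ℚ) = wreathPow (M'.map (algebraMap ℤ ℚ)) w Par.s Par.s →
      N * N' = 1 := by
    intro M M' h N N' hN hN'
    refine hinj ?_
    change (N * N').map (algebraMap ℤ ℚ) = (1 : Matrix _ _ ℤ).map (algebraMap ℤ ℚ)
    rw [Matrix.map_mul, hN, hN', ← wreathPow_mul, ← Matrix.map_mul, h,
      Matrix.map_one _ (map_zero _) (map_one _), Matrix.map_one _ (map_zero _) (map_one _),
      wreathPow_one]
  obtain ⟨N, hN⟩ := hex U
  obtain ⟨N', hN'⟩ := hex ((U⁻¹ : Matrix.GeneralLinearGroup T ℤ) : Matrix T T ℤ)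
  refine ⟨⟨N, N', hmul _ _ ?_ _ _ hN hN', hmul _ _ ?_ _ _ hN' hN⟩, hN⟩
  · exact U.mul_inv
  · exact U.inv_mul

end

end WreathPower

end

/-! ### The proposition -/

theorem mainTheorem9 {T : Type*} {Q : Type*} [Fintype T] [DecidableEq T] [Fintype Q] [DecidableEq Q]
    (A B : Matrix T Q ℚ) (hAB : WreathPower.EquivalentOver ℤ A B) (w : ℕ) :
    WreathPower.EquivalentOver ℤ
      (WreathPower.wreathPow A w WreathPower.Par.s WreathPower.Par.s)
      (WreathPower.wreathPow B w WreathPower.Par.s WreathPower.Par.s) := by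
  obtain ⟨U, V, rfl⟩ := hAB
  obtain ⟨U', hU⟩ := WreathPower.exists_GL_wreathPow U w
  obtain ⟨V', hV⟩ := WreathPower.exists_GL_wreathPow V w
  exact ⟨U', V', by rw [hU, hV, WreathPower.wreathPow_mul, WreathPower.wreathPow_mul]⟩
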